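/- Let $\Bbbk$ be a field, let $n,d\ge 1$ be integers, and let $q\in\Bbbk^*$ be not a root of unity (that is, $q^m\neq 1$ for all $m\ge 1$). Let $A(n,d,\underline{q})$, with $\underline{q}=(q,\ldots,q)$, be the associative unital $\Bbbk$-algebra generated by $x_i,y_i,h_i,h_i^{-1}$ $(1\le i\le n)$ subject to the relations $$x_ih_i=q\,h_ix_i,\quad y_ih_i=q^{-1}h_iy_i,\quad x_iy_i=(qh_i)^d-1,\quad y_ix_i=h_i^d-1,\quad h_ih_i^{-1}=h_i^{-1}h_i=1$$ for all $i$, and $$h_ih_j=h_jh_i,\quad h_ix_j=x_jh_i,\quad h_iy_j=y_jh_i,\quad x_ix_j=x_jx_i,\quad x_iy_j=y_jx_i,\quad y_iy_j=y_jy_i$$ for all $i\neq j$. (Equivalently, it is the tensor product over $\Bbbk$ of $n$ copies of the generalized Weyl algebra $\Bbbk[h^{\pm1}](\sigma,h^d-1)$ with $\sigma(h)=qh$.) Then every endomorphism of the unital $\Bbbk$-algebra $A(n,d,\underline{q})$ is an automorphism. -/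

import Mathlib

/-- The generators `x_i, y_i, h_i, h_i⁻¹` (`i = 1, …, n`) of the quantum Weyl analogue algebra. -/
inductive QwaGen (n : ℕ) : Type
  | x (i : Fin n) : QwaGen n
  | y (i : Fin n) : QwaGen n
  | h (i : Fin n) : QwaGen n
  | hInv (i : Fin n) : QwaGen n

namespace Qwa

variable {K : Type*} [Field K] {n : ℕ}

/-- The generator `x_i` in the free algebra. -/
abbrev fx (K : Type*) [Field K] {n : ℕ} (i : Fin n) : FreeAlgebra K (QwaGen n) :=
  FreeAlgebra.ι K (QwaGen.x i)

/-- The generator `y_i` in the free algebra. -/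
abbrev fy (K : Type*) [Field K] {n : ℕ} (i : Fin n) : FreeAlgebra K (QwaGen n) :=
  FreeAlgebra.ι K (QwaGen.y i)

/-- The generator `h_i` in the free algebra. -/
abbrev fh (K : Type*) [Field K] {n : ℕ} (i : Fin n) : FreeAlgebra K (QwaGen n) :=
  FreeAlgebra.ι K (QwaGen.h i)

/-- The generator `h_i⁻¹` in the free algebra. -/
abbrev fhInv (K : Type*) [Field K] {n : ℕ} (i : Fin n) : FreeAlgebra K (QwaGen n) :=
  FreeAlgebra.ι K (QwaGen.hInv i)

/-- The defining relations of the quantum Weyl analogue algebra `A(n, d, (q_1, …, q_n))`,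
with `a_d(t) = t ^ d - 1`. -/
inductive Rel (d : ℕ) (q : Fin n → Kˣ) :
    FreeAlgebra K (QwaGen n) → FreeAlgebra K (QwaGen n) → Prop
  | x_h (i : Fin n) : Rel d q (fx K i * fh K i) ((q i : K) • (fh K i * fx K i))
  | y_h (i : Fin n) : Rel d q (fy K i * fh K i) ((q i : K)⁻¹ • (fh K i * fy K i))
  | x_y (i : Fin n) : Rel d q (fx K i * fy K i) (((q i : K) • fh K i) ^ d - 1)
  | y_x (i : Fin n) : Rel d q (fy K i * fx K i) (fh K i ^ d - 1)
  | h_hInv (i : Fin n) : Rel d q (fh K i * fhInv K i) 1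
  | hInv_h (i : Fin n) : Rel d q (fhInv K i * fh K i) 1
  | comm_h_h (i j : Fin n) (hij : i ≠ j) : Rel d q (fh K i * fh K j) (fh K j * fh K i)
  | comm_h_x (i j : Fin n) (hij : i ≠ j) : Rel d q (fh K i * fx K j) (fx K j * fh K i)
  | comm_h_y (i j : Fin n) (hij : i ≠ j) : Rel d q (fh K i * fy K j) (fy K j * fh K i)
  | comm_x_x (i j : Fin n) (hij : i ≠ j) : Rel d q (fx K i * fx K j) (fx K j * fx K i)
  | comm_x_y (i j : Fin n) (hij : i ≠ j) : Rel d q (fx K i * fy K j) (fy K j * fx K i)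
  | comm_y_y (i j : Fin n) (hij : i ≠ j) : Rel d q (fy K i * fy K j) (fy K j * fy K i)

end Qwa

/-- The quantum Weyl analogue algebra `A(n, d, (q_1, …, q_n))`: the tensor product over `K` of the
generalized Weyl algebras `K[h_i^{±1}](σ_i, h_i ^ d - 1)` with `σ_i(h_i) = q_i h_i`, that is, the
associative unital `K`-algebra generated by the `x_i, y_i, h_i, h_i⁻¹` subject to the relations
`Qwa.Rel d q`. -/
abbrev QwaAlgebra {K : Type*} [Field K] {n : ℕ} (d : ℕ) (q : Fin n → Kˣ) : Type _ :=
  RingQuot (Qwa.Rel d q)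

/-! The algebra embeds in a quantum torus, the skew group algebra of `ℤⁿ` over the Laurent
polynomials in the `h_i`, with `y_i` sent to `(h_i^d - 1) x_i⁻¹` (`toTorus_injective`). The image
remembers the defining polynomial: a component of degree `β` is divisible by `h_j^d - 1` whenever
`β_j < 0` (`binom_dvd_comp_toTorus`). Units of the torus are homogeneous, so this divisibility
leaves only the scalar multiples of the `h^a` as units of the algebra
(`exists_toTorus_eq_of_mul_eq_one`).

An endomorphism `ψ` therefore sends `h_i` to `c_i h^(a_i)`. Since `q` is not a root of unity,
q-commutation with these images confines the degrees of `ψ(x_k)` to the solutions of `A γ = e_k`,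
where `A` has rows `a_i`. As `ψ(x_k) ≠ 0`, solutions exist, `A` is invertible over `ℤ`, and
`ψ(x_k)`, `ψ(y_k)` are homogeneous of opposite degrees `b_k`, `-b_k` (`exists_toTorus_map_eq_mono`).
Their product is a binomial in `h^(d a_k)`, yet it is divisible by a binomial in `h_j^d` for each
`j` in the support of `b_k`; this forces `a_k = b_k = ±e_j`
(`exists_eq_single_of_dotProduct_eq_one`). So up to Laurent units `ψ` permutes the pairs `{x_j,
y_j}`, possibly swapping members of a pair, and is surjective.

For injectivity, invertibility of `A` makes `ψ` injective on Laurent polynomials, and distinct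
degrees `β` have images with disjoint degree supports. A kernel element thus has all its homogeneous
parts in the kernel, and multiplying by a monomial of opposite degree moves each part into the
Laurent algebra. -/

/-- The algebra of Laurent polynomials in `n` commuting variables. -/
abbrev LaurentAlg (K : Type*) [Field K] (n : ℕ) : Type _ := AddMonoidAlgebra K (Fin n → ℤ)

/-! ### Laurent polynomials: units, shifts and binomials -/

namespace LaurentAlg

open AddMonoidAlgebra

variable {K : Type*} [Field K] {n : ℕ}

/-- If the supports of `f` and its inverse were not both singletons, the two-unique-sums property of
`ℤⁿ` would give two distinct uniquely attained sums. Neither coefficient can cancel in the product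
`1`, so both sums are `0`, against uniqueness. -/
theorem exists_eq_single_of_isUnit {f : LaurentAlg K n} (hf : IsUnit f) :
    ∃ a c, c ≠ 0 ∧ f = single a c := by
  obtain ⟨g, hg⟩ := hf.exists_right_inv
  have hf0 : f.coeff.support.Nonempty := by
    rw [Finsupp.support_nonempty_iff]
    intro h
    rw [coeff_eq_zero] at h
    simp [h] at hg
  have hg0 : g.coeff.support.Nonempty := by
    rw [Finsupp.support_nonempty_iff]
    intro h
    rw [coeff_eq_zero] at h
    simp [h] at hg
  have key : ∀ p ∈ f.coeff.support ×ˢ g.coeff.support,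
      UniqueAdd f.coeff.support g.coeff.support p.1 p.2 → p.1 + p.2 = 0 := by
    intro p hp hu
    by_contra h
    have h1 := coeff_mul_add_of_uniqueAdd hu
    rw [Finset.mem_product, Finsupp.mem_support_iff, Finsupp.mem_support_iff] at hp
    rw [hg, one_def, coeff_single, Finsupp.single_eq_of_ne h] at h1
    exact mul_ne_zero hp.1 hp.2 h1.symm
  have hcard : ¬ 1 < f.coeff.support.card * g.coeff.support.card := by
    intro h
    obtain ⟨p, hp, r, hr, hpr, hpu, hru⟩ := TwoUniqueSums.uniqueAdd_of_one_lt_card h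
    have h1 := key p hp hpu
    have h2 := key r hr hru
    rw [Finset.mem_product] at hr
    have := hpu hr.1 hr.2 (h2.trans h1.symm)
    exact hpr (Prod.ext this.1.symm this.2.symm)
  have hf1 : f.coeff.support.card = 1 := by
    have := hf0.card_pos
    have := hg0.card_pos
    nlinarith
  obtain ⟨a, c, hc, h⟩ := Finsupp.card_support_eq_one'.1 hf1
  exact ⟨a, c, hc, coeff_injective h⟩

theorem isUnit_single (a : Fin n → ℤ) {c : K} (hc : c ≠ 0) :
    IsUnit (single a c : LaurentAlg K n) := by
  refine IsUnit.of_mul_eq_one (single (-a) c⁻¹) ?_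
  rw [single_mul_single, add_neg_cancel, mul_inv_cancel₀ hc, one_def]

/-- The automorphism `σ^β` of the Laurent algebra with `σ^β(h^a) = q^(β · a) h^a`. -/
noncomputable def shift (q : Kˣ) (β : Fin n → ℤ) : LaurentAlg K n →ₐ[K] LaurentAlg K n :=
  AddMonoidAlgebra.lift K (LaurentAlg K n) (Fin n → ℤ)
    { toFun := fun a => single a.toAdd ((q ^ (β ⬝ᵥ a.toAdd) : Kˣ) : K)
      map_one' := by simp [one_def]
      map_mul' := by
        intro a b
        rw [single_mul_single, toAdd_mul, dotProduct_add, zpow_add, Units.val_mul] }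

theorem shift_single (q : Kˣ) (β a : Fin n → ℤ) (c : K) :
    shift q β (single a c) = single a (c * ((q ^ (β ⬝ᵥ a) : Kˣ) : K)) := by
  rw [shift, lift_single]
  simp [smul_single]

theorem shift_zero (q : Kˣ) (f : LaurentAlg K n) : shift q 0 f = f := by
  induction f using AddMonoidAlgebra.induction_linear with
  | zero => simp
  | add f g hf hg => rw [map_add, hf, hg]
  | single a c => simp [shift_single]

theorem shift_add (q : Kˣ) (β γ : Fin n → ℤ) (f : LaurentAlg K n) :
    shift q (β + γ) f = shift q β (shift q γ f) := by
  induction f using AddMonoidAlgebra.induction_linear with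
  | zero => simp
  | add f g hf hg => simp only [map_add, hf, hg]
  | single a c =>
    simp only [shift_single, add_dotProduct, zpow_add, Units.val_mul]
    congr 1
    ring

theorem shift_neg_shift (q : Kˣ) (β : Fin n → ℤ) (f : LaurentAlg K n) :
    shift q (-β) (shift q β f) = f := by
  rw [← shift_add, neg_add_cancel, shift_zero]

theorem shift_injective (q : Kˣ) (β : Fin n → ℤ) : Function.Injective (shift (n := n) q β) :=
  Function.LeftInverse.injective (shift_neg_shift q β)

theorem isUnit_of_isUnit_shift {q : Kˣ} {β : Fin n → ℤ} {f : LaurentAlg K n}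
    (h : IsUnit (shift q β f)) : IsUnit f := by
  simpa only [shift_neg_shift] using h.map (shift q (-β))

/-- The binomial `b h^a - 1`. -/
noncomputable def binom (a : Fin n → ℤ) (b : K) : LaurentAlg K n := single a b - 1

theorem shift_binom (q : Kˣ) (β a : Fin n → ℤ) (b : K) :
    shift q β (binom a b) = binom a (b * ((q ^ (β ⬝ᵥ a) : Kˣ) : K)) := by
  rw [binom, map_sub, map_one, shift_single, binom]

theorem not_isUnit_binom {a : Fin n → ℤ} (ha : a ≠ 0) {b : K} (hb : b ≠ 0) :
    ¬ IsUnit (binom a b) := by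
  intro h
  obtain ⟨e, c, -, h⟩ := exists_eq_single_of_isUnit h
  have h1 := congrArg (fun f => f.coeff a) h
  have h2 := congrArg (fun f => f.coeff 0) h
  simp only [binom, one_def, coeff_sub, coeff_single, Finsupp.sub_apply, Finsupp.single_apply,
    ha, ha.symm, if_true, if_false] at h1 h2
  split_ifs at h1 h2 with h3 h4
  · exact ha (h3.symm.trans h4)
  · simp at h2
  · simp [hb] at h1
  · simp [hb] at h1

theorem binom_ne_zero {a : Fin n → ℤ} (ha : a ≠ 0) (b : K) : binom a b ≠ 0 := by
  intro h
  have h2 := congrArg (fun f => f.coeff 0) h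
  simp [binom, one_def, ha] at h2

/-- Division with remainder leaves the constant `b'/b - 1`, which a non-unit divides only if it
vanishes. -/
theorem eq_of_binom_dvd_binom {a : Fin n → ℤ} (ha : a ≠ 0) {b b' : K} (hb : b ≠ 0)
    (h : binom a b ∣ binom a b') : b = b' := by
  by_contra hne
  have h1 : binom a b' = single 0 (b' / b) * binom a b + single 0 (b' / b - 1) := by
    simp only [binom, mul_sub, single_mul_single, zero_add, div_mul_cancel₀ _ hb, single_sub,
      one_def, mul_one]
    abel
  rw [h1] at h
  have h2 := (dvd_add_right (dvd_mul_left (binom a b) _)).1 h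
  refine not_isUnit_binom ha hb (isUnit_of_dvd_unit h2 (isUnit_single 0 ?_))
  rw [sub_ne_zero]
  intro h3
  exact hne ((div_eq_one_iff_eq hb).1 h3).symm

theorem isUnit_of_binom_mul_eq {a : Fin n → ℤ} (ha : a ≠ 0) {b b' : K} (hb : b ≠ 0)
    {u : LaurentAlg K n} (h : binom a b * u = binom a b') : IsUnit u := by
  obtain rfl := eq_of_binom_dvd_binom ha hb ⟨u, h.symm⟩
  rw [mul_right_eq_self₀] at h
  rcases h with h | h
  · exact h ▸ isUnit_one
  · exact absurd h (binom_ne_zero ha b)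

theorem isUnit_of_binom_mul_eq_neg {a : Fin n → ℤ} (ha : a ≠ 0) {b b' : K} (hb : b ≠ 0)
    (hb' : b' ≠ 0) {u : LaurentAlg K n} (h : binom a b * u = binom (-a) b') : IsUnit u := by
  -- A binomial in `h^(-a)` is a unit times a binomial in `h^a`: `b' h^(-a) - 1 = -b' h^(-a) (b'⁻¹
  -- h^a - 1)`.
  have h1 : binom a b * (single a (-b'⁻¹) * u) = binom a b'⁻¹ := by
    rw [mul_left_comm, h]
    simp only [binom, mul_sub, single_mul_single, one_def, add_neg_cancel, add_zero, mul_one,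
      neg_mul, inv_mul_cancel₀ hb', single_neg]
    abel
  exact isUnit_of_mul_isUnit_right (isUnit_of_binom_mul_eq ha hb h1)

theorem zpow_injective_of_pow_ne_one {q : Kˣ} (hq : ∀ m : ℕ, 1 ≤ m → q ^ m ≠ 1) :
    Function.Injective (fun k : ℤ => q ^ k) := by
  rw [injective_zpow_iff_not_isOfFinOrder, isOfFinOrder_iff_pow_eq_one]
  rintro ⟨m, hm, h⟩
  exact hq m hm h

/-- If a binomial in the single variable `h_j` divides `b' h^a - 1`, then `h^a` is a power
of `h_j`. -/
theorem eq_zero_of_binom_dvd {q : Kˣ} (hq : ∀ m : ℕ, 1 ≤ m → q ^ m ≠ 1) {j l : Fin n}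
    (hjl : l ≠ j) {k : ℤ} (hk : k ≠ 0) {b b' : K} (hb : b ≠ 0) (hb' : b' ≠ 0)
    {a : Fin n → ℤ} (h : binom (Pi.single j k) b ∣ binom a b') : a l = 0 := by
  by_contra ha
  -- Shifting in the direction `l ≠ j` fixes the divisor but rescales `h^a` by `q^(a_l)`. The
  -- divisor then divides the difference of the two multiples, a monomial that is a unit when `a_l ≠
  -- 0`.
  have h1 := map_dvd (shift q (Pi.single l 1)) h
  rw [shift_binom, shift_binom, single_dotProduct, single_dotProduct, Pi.single_eq_of_ne hjl,
    mul_zero, zpow_zero, Units.val_one, mul_one, one_mul] at h1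
  have h2 := dvd_sub h h1
  have h3 : binom a b' - binom a (b' * ((q ^ a l : Kˣ) : K))
      = single a (b' * (1 - ((q ^ a l : Kˣ) : K))) := by
    rw [binom, binom, mul_sub, single_sub, mul_one]
    abel
  rw [h3] at h2
  refine not_isUnit_binom (by simpa using hk) hb (isUnit_of_dvd_unit h2 (isUnit_single _ ?_))
  refine mul_ne_zero hb' (sub_ne_zero.2 fun h4 => ha ?_)
  apply zpow_injective_of_pow_ne_one hq
  simp only [zpow_zero]
  exact Units.ext h4.symm

end LaurentAlg

/-! ### The quantum torus: homogeneous components and units -/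

/-- The group `ℤⁿ` acting on the Laurent algebra through the shifts with parameter `q`. -/
def ShiftGroup {K : Type*} [Field K] (_q : Kˣ) (n : ℕ) : Type := Multiplicative (Fin n → ℤ)

namespace ShiftGroup

variable {K : Type*} [Field K] {n : ℕ} (q : Kˣ)

instance : CommGroup (ShiftGroup q n) := inferInstanceAs (CommGroup (Multiplicative (Fin n → ℤ)))

instance : TwoUniqueProds (ShiftGroup q n) :=
  inferInstanceAs (TwoUniqueProds (Multiplicative (Fin n → ℤ)))

/-- The element of the shift group with exponent vector `β`. -/
def of (β : Fin n → ℤ) : ShiftGroup q n := Multiplicative.ofAdd β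

theorem of_injective : Function.Injective (of (n := n) q) := fun _ _ h => h

theorem of_surjective : Function.Surjective (of (n := n) q) := fun β => ⟨β, rfl⟩

theorem of_add (β γ : Fin n → ℤ) : of q (β + γ) = of q β * of q γ := rfl

noncomputable instance : MulSemiringAction (ShiftGroup q n) (LaurentAlg K n) where
  smul β f := LaurentAlg.shift q (Multiplicative.toAdd (α := Fin n → ℤ) β) f
  one_smul f := LaurentAlg.shift_zero q f
  mul_smul _ _ f := LaurentAlg.shift_add q _ _ f
  smul_zero _ := map_zero _
  smul_add _ := map_add _
  smul_one _ := map_one _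
  smul_mul _ := map_mul _

theorem of_smul (β : Fin n → ℤ) (f : LaurentAlg K n) :
    of q β • f = LaurentAlg.shift q β f := rfl

instance : SMulCommClass (ShiftGroup q n) K (LaurentAlg K n) where
  smul_comm β c f := map_smul (LaurentAlg.shift q (Multiplicative.toAdd (α := Fin n → ℤ) β)) c f

end ShiftGroup

/-- The quantum torus: the skew group algebra of the shift group over the Laurent algebra. -/
abbrev QTorus {K : Type*} [Field K] (q : Kˣ) (n : ℕ) : Type _ :=
  SkewMonoidAlgebra (LaurentAlg K n) (ShiftGroup q n)

namespace QTorus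

open LaurentAlg

variable {K : Type*} [Field K] {n : ℕ} {q : Kˣ}

/-- The homogeneous element `f x^β` of the quantum torus. -/
noncomputable def mono (q : Kˣ) (β : Fin n → ℤ) (f : LaurentAlg K n) : QTorus q n :=
  SkewMonoidAlgebra.single (ShiftGroup.of q β) f

/-- The component of degree `β` of an element of the quantum torus. -/
noncomputable def comp (b : QTorus q n) (β : Fin n → ℤ) : LaurentAlg K n :=
  b.coeff (ShiftGroup.of q β)

theorem ext_comp {b c : QTorus q n} (h : ∀ β, comp b β = comp c β) : b = c := by
  refine SkewMonoidAlgebra.ext fun a => ?_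
  obtain ⟨β, rfl⟩ := ShiftGroup.of_surjective q a
  exact h β

theorem comp_mono_self (β : Fin n → ℤ) (f : LaurentAlg K n) : comp (mono q β f) β = f := by
  simp [comp, mono]

theorem comp_mono_of_ne {β γ : Fin n → ℤ} (h : γ ≠ β) (f : LaurentAlg K n) :
    comp (mono q β f) γ = 0 := by
  rw [comp, mono, SkewMonoidAlgebra.coeff_single, Finsupp.single_eq_of_ne]
  exact fun h' => h (ShiftGroup.of_injective q h')

theorem comp_zero (β : Fin n → ℤ) : comp (0 : QTorus q n) β = 0 := rfl

theorem comp_add (b c : QTorus q n) (β : Fin n → ℤ) : comp (b + c) β = comp b β + comp c β := by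
  simp [comp]

theorem comp_smul (a : K) (b : QTorus q n) (β : Fin n → ℤ) : comp (a • b) β = a • comp b β := rfl

theorem comp_sum {ι : Type*} (s : Finset ι) (f : ι → QTorus q n) (β : Fin n → ℤ) :
    comp (∑ i ∈ s, f i) β = ∑ i ∈ s, comp (f i) β :=
  map_sum (AddMonoidHom.mk' (fun b : QTorus q n => comp b β) fun b c => comp_add b c β) f s

theorem eq_mono_of_comp {b : QTorus q n} {β : Fin n → ℤ} (h : ∀ γ, comp b γ ≠ 0 → γ = β) :
    b = mono q β (comp b β) := by
  refine ext_comp fun γ => ?_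
  by_cases hγ : γ = β
  · rw [hγ, comp_mono_self]
  · rw [comp_mono_of_ne hγ]
    by_contra h0
    exact hγ (h γ h0)

theorem mono_injective (β : Fin n → ℤ) : Function.Injective (mono q β) := fun f g h => by
  rw [← comp_mono_self (q := q) β f, h, comp_mono_self]

theorem mono_zero_right (β : Fin n → ℤ) : mono q β 0 = 0 := SkewMonoidAlgebra.single_zero _

theorem mono_zero_one : mono q (0 : Fin n → ℤ) 1 = 1 := rfl

theorem mono_add (β : Fin n → ℤ) (f g : LaurentAlg K n) :
    mono q β (f + g) = mono q β f + mono q β g := SkewMonoidAlgebra.single_add _ _ _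

theorem mono_sub (β : Fin n → ℤ) (f g : LaurentAlg K n) :
    mono q β (f - g) = mono q β f - mono q β g := by
  rw [eq_sub_iff_add_eq, ← mono_add, sub_add_cancel]

theorem smul_mono (a : K) (β : Fin n → ℤ) (f : LaurentAlg K n) :
    a • mono q β f = mono q β (a • f) := SkewMonoidAlgebra.smul_single _ _ _

theorem mono_mul_mono (β γ : Fin n → ℤ) (f g : LaurentAlg K n) :
    mono q β f * mono q γ g = mono q (β + γ) (f * shift q β g) := by
  rw [mono, mono, SkewMonoidAlgebra.single_mul_single, ShiftGroup.of_smul, mono,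
    ShiftGroup.of_add]

theorem comp_mono_zero_mul (f : LaurentAlg K n) (b : QTorus q n) (β : Fin n → ℤ) :
    comp (mono q 0 f * b) β = f * comp b β :=
  SkewMonoidAlgebra.coeff_single_one_mul b f _

theorem comp_mul_mono_zero (f : LaurentAlg K n) (b : QTorus q n) (β : Fin n → ℤ) :
    comp (b * mono q 0 f) β = comp b β * shift q β f :=
  SkewMonoidAlgebra.coeff_mul_single_one b f _

theorem mono_zero_pow (f : LaurentAlg K n) (k : ℕ) : mono q 0 f ^ k = mono q 0 (f ^ k) := by
  induction k with
  | zero => rw [pow_zero, pow_zero, mono_zero_one]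
  | succ k ih => rw [pow_succ, ih, mono_mul_mono, shift_zero, add_zero, pow_succ]

theorem coeff_mul_of_uniqueMul {b c : QTorus q n} {β γ : ShiftGroup q n}
    (h : UniqueMul b.support c.support β γ) :
    (b * c).coeff (β * γ) = b.coeff β * β • c.coeff γ := by
  classical
  rw [SkewMonoidAlgebra.coeff_mul, SkewMonoidAlgebra.sum_def', Finset.sum_eq_single β]
  · rw [SkewMonoidAlgebra.sum_def', Finset.sum_eq_single γ]
    · simp
    · intro γ' hγ' hne
      by_cases hβ : β ∈ b.support
      · rw [if_neg]
        exact fun he => hne (h hβ hγ' he).2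
      · rw [SkewMonoidAlgebra.notMem_support_iff.1 hβ]
        simp
    · intro hγ
      rw [SkewMonoidAlgebra.notMem_support_iff.1 hγ]
      simp
  · intro β' hβ' hne
    rw [SkewMonoidAlgebra.sum_def']
    refine Finset.sum_eq_zero fun γ' hγ' => ?_
    rw [if_neg]
    exact fun he => hne (h hβ' hγ' he).1
  · intro hβ
    rw [SkewMonoidAlgebra.notMem_support_iff.1 hβ, SkewMonoidAlgebra.sum_def']
    simp

/-- Units of the quantum torus are homogeneous. -/
theorem exists_eq_mono_of_mul_eq_one {b c : QTorus q n} (h : b * c = 1) :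
    ∃ β f g, b = mono q β f ∧ c = mono q (-β) g ∧ f * shift q β g = 1 := by
  have hb0 : b.support.Nonempty := by
    rw [Finset.nonempty_iff_ne_empty, Ne, SkewMonoidAlgebra.support_eq_empty]
    rintro rfl
    rw [zero_mul] at h
    exact zero_ne_one h
  have hc0 : c.support.Nonempty := by
    rw [Finset.nonempty_iff_ne_empty, Ne, SkewMonoidAlgebra.support_eq_empty]
    rintro rfl
    rw [mul_zero] at h
    exact zero_ne_one h
  -- As for Laurent polynomials: a uniquely attained product of degrees has coefficient `b_β ·
  -- σ^β(c_γ)`, nonzero because the Laurent algebra is a domain and the shifts are injective.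
  have key : ∀ p ∈ b.support ×ˢ c.support,
      UniqueMul b.support c.support p.1 p.2 → p.1 * p.2 = 1 := by
    intro p hp hu
    by_contra hne
    have h1 := coeff_mul_of_uniqueMul hu
    rw [Finset.mem_product, SkewMonoidAlgebra.mem_support_iff,
      SkewMonoidAlgebra.mem_support_iff] at hp
    rw [h, SkewMonoidAlgebra.coeff_one, Finsupp.single_eq_of_ne hne] at h1
    refine mul_ne_zero hp.1 ?_ h1.symm
    rw [Ne, smul_eq_zero_iff_eq]
    exact hp.2
  have hcard : ¬ 1 < b.support.card * c.support.card := by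
    intro h
    obtain ⟨p, hp, r, hr, hpr, hpu, hru⟩ := TwoUniqueProds.uniqueMul_of_one_lt_card h
    have h1 := key p hp hpu
    have h2 := key r hr hru
    rw [Finset.mem_product] at hr
    have := hpu hr.1 hr.2 (h2.trans h1.symm)
    exact hpr (Prod.ext this.1.symm this.2.symm)
  have hb1 : b.support.card = 1 := by
    have := hb0.card_pos
    have := hc0.card_pos
    nlinarith
  have hc1 : c.support.card = 1 := by
    have := hb0.card_pos
    have := hc0.card_pos
    nlinarith
  obtain ⟨β, hβ⟩ := Finset.card_eq_one.1 hb1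
  obtain ⟨γ, hγ⟩ := Finset.card_eq_one.1 hc1
  obtain ⟨β, rfl⟩ := ShiftGroup.of_surjective q β
  obtain ⟨γ, rfl⟩ := ShiftGroup.of_surjective q γ
  have hb : b = mono q β (comp b β) := eq_mono_of_comp fun δ hδ => by
    have := SkewMonoidAlgebra.mem_support_iff.2 hδ
    rw [hβ, Finset.mem_singleton] at this
    exact ShiftGroup.of_injective q this
  have hc : c = mono q γ (comp c γ) := eq_mono_of_comp fun δ hδ => by
    have := SkewMonoidAlgebra.mem_support_iff.2 hδ
    rw [hγ, Finset.mem_singleton] at this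
    exact ShiftGroup.of_injective q this
  have h1 := h
  rw [hb, hc, mono_mul_mono, ← mono_zero_one] at h1
  have h2 : β + γ = 0 := by
    by_contra hne
    have h3 := congrArg (fun b => comp b 0) h1
    simp only [comp_mono_self] at h3
    rw [comp_mono_of_ne (Ne.symm hne)] at h3
    exact zero_ne_one h3
  obtain rfl : γ = -β := (neg_eq_of_add_eq_zero_right h2).symm
  rw [add_neg_cancel] at h1
  exact ⟨β, _, _, hb, hc, mono_injective 0 h1⟩

/-- An element that commutes with a monomial of degree zero up to a power of `q` is supported
in the degrees given by a linear equation. -/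
theorem dotProduct_eq_of_comp_ne_zero (hq : ∀ m : ℕ, 1 ≤ m → q ^ m ≠ 1) {b : QTorus q n}
    {a : Fin n → ℤ} {c : K} (hc : c ≠ 0) {m : ℤ}
    (h : b * mono q 0 (AddMonoidAlgebra.single a c)
      = ((q ^ m : Kˣ) : K) • (mono q 0 (AddMonoidAlgebra.single a c) * b))
    {γ : Fin n → ℤ} (hγ : comp b γ ≠ 0) : a ⬝ᵥ γ = m := by
  have h1 := congrArg (fun b => comp b γ) h
  simp only [comp_smul, comp_mono_zero_mul, comp_mul_mono_zero, shift_single] at h1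
  rw [mul_comm (comp b γ), ← smul_mul_assoc, AddMonoidAlgebra.smul_single, smul_eq_mul] at h1
  -- In degree `γ` the relation compares `q^(γ · a)` with `q^m` times the same nonzero element.
  have h2 := mul_right_cancel₀ hγ h1
  rw [AddMonoidAlgebra.single_right_inj, mul_comm] at h2
  have h3 := Units.ext (mul_right_cancel₀ hc h2)
  rw [dotProduct_comm]
  exact zpow_injective_of_pow_ne_one hq h3

end QTorus

/-! ### The algebra: generators and relations -/

namespace QwaAlgebra

open LaurentAlg QTorus

variable {K : Type*} [Field K] {n d : ℕ} {q : Kˣ}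

/-- The generator `x_i`. -/
noncomputable def x (d : ℕ) (q : Kˣ) (i : Fin n) : QwaAlgebra d (fun _ : Fin n => q) :=
  RingQuot.mkAlgHom K _ (Qwa.fx K i)

/-- The generator `y_i`. -/
noncomputable def y (d : ℕ) (q : Kˣ) (i : Fin n) : QwaAlgebra d (fun _ : Fin n => q) :=
  RingQuot.mkAlgHom K _ (Qwa.fy K i)

/-- The generator `h_i`. -/
noncomputable def h (d : ℕ) (q : Kˣ) (i : Fin n) : QwaAlgebra d (fun _ : Fin n => q) :=
  RingQuot.mkAlgHom K _ (Qwa.fh K i)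

/-- The generator `h_i⁻¹`. -/
noncomputable def hInv (d : ℕ) (q : Kˣ) (i : Fin n) : QwaAlgebra d (fun _ : Fin n => q) :=
  RingQuot.mkAlgHom K _ (Qwa.fhInv K i)

theorem mk_eq_of_rel {a b : FreeAlgebra K (QwaGen n)} (h : Qwa.Rel d (fun _ : Fin n => q) a b) :
    RingQuot.mkAlgHom K (Qwa.Rel d (fun _ : Fin n => q)) a = RingQuot.mkAlgHom K _ b :=
  RingQuot.mkAlgHom_rel K h

theorem x_mul_h (i : Fin n) : x d q i * h d q i = (q : K) • (h d q i * x d q i) := by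
  have := mk_eq_of_rel (q := q) (Qwa.Rel.x_h (d := d) i)
  simp only [map_mul, map_smul] at this
  exact this

theorem y_mul_h (i : Fin n) : y d q i * h d q i = (q : K)⁻¹ • (h d q i * y d q i) := by
  have := mk_eq_of_rel (q := q) (Qwa.Rel.y_h (d := d) i)
  simp only [map_mul, map_smul] at this
  exact this

theorem x_mul_y (i : Fin n) : x d q i * y d q i = ((q : K) • h d q i) ^ d - 1 := by
  have := mk_eq_of_rel (q := q) (Qwa.Rel.x_y (d := d) i)
  simp only [map_mul, map_smul, map_sub, map_pow, map_one] at this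
  exact this

theorem y_mul_x (i : Fin n) : y d q i * x d q i = h d q i ^ d - 1 := by
  have := mk_eq_of_rel (q := q) (Qwa.Rel.y_x (d := d) i)
  simp only [map_mul, map_sub, map_pow, map_one] at this
  exact this

theorem h_mul_hInv (i : Fin n) : h d q i * hInv d q i = 1 := by
  have := mk_eq_of_rel (q := q) (Qwa.Rel.h_hInv (d := d) i)
  simp only [map_mul, map_one] at this
  exact this

theorem hInv_mul_h (i : Fin n) : hInv d q i * h d q i = 1 := by
  have := mk_eq_of_rel (q := q) (Qwa.Rel.hInv_h (d := d) i)
  simp only [map_mul, map_one] at this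
  exact this

theorem commute_h_h {i j : Fin n} (hij : i ≠ j) : Commute (h d q i) (h d q j) := by
  have := mk_eq_of_rel (q := q) (Qwa.Rel.comm_h_h (d := d) i j hij)
  simp only [map_mul] at this
  exact this

theorem commute_h_x {i j : Fin n} (hij : i ≠ j) : Commute (h d q i) (x d q j) := by
  have := mk_eq_of_rel (q := q) (Qwa.Rel.comm_h_x (d := d) i j hij)
  simp only [map_mul] at this
  exact this

theorem commute_h_y {i j : Fin n} (hij : i ≠ j) : Commute (h d q i) (y d q j) := by
  have := mk_eq_of_rel (q := q) (Qwa.Rel.comm_h_y (d := d) i j hij)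
  simp only [map_mul] at this
  exact this

theorem commute_x_x {i j : Fin n} (hij : i ≠ j) : Commute (x d q i) (x d q j) := by
  have := mk_eq_of_rel (q := q) (Qwa.Rel.comm_x_x (d := d) i j hij)
  simp only [map_mul] at this
  exact this

theorem commute_x_y {i j : Fin n} (hij : i ≠ j) : Commute (x d q i) (y d q j) := by
  have := mk_eq_of_rel (q := q) (Qwa.Rel.comm_x_y (d := d) i j hij)
  simp only [map_mul] at this
  exact this

theorem commute_y_y {i j : Fin n} (hij : i ≠ j) : Commute (y d q i) (y d q j) := by
  have := mk_eq_of_rel (q := q) (Qwa.Rel.comm_y_y (d := d) i j hij)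
  simp only [map_mul] at this
  exact this

/-- A subalgebra containing the generators is everything. -/
theorem subalgebra_eq_top {S : Subalgebra K (QwaAlgebra d (fun _ : Fin n => q))}
    (hx : ∀ i, x d q i ∈ S) (hy : ∀ i, y d q i ∈ S) (hh : ∀ i, h d q i ∈ S)
    (hi : ∀ i, hInv d q i ∈ S) : S = ⊤ := by
  rw [Algebra.eq_top_iff]
  intro a
  obtain ⟨a, rfl⟩ := RingQuot.mkAlgHom_surjective K _ a
  induction a with
  | grade0 r => simpa only [AlgHom.commutes] using S.algebraMap_mem r
  | grade1 g =>
    cases g with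
    | x i => exact hx i
    | y i => exact hy i
    | h i => exact hh i
    | hInv i => exact hi i
  | mul a b ha hb => rw [map_mul]; exact S.mul_mem ha hb
  | add a b ha hb => rw [map_add]; exact S.add_mem ha hb

/-! ### The Laurent polynomials inside the algebra -/

/-- The unit `h_i`. -/
noncomputable def hUnit (d : ℕ) (q : Kˣ) (i : Fin n) : (QwaAlgebra d (fun _ : Fin n => q))ˣ :=
  ⟨h d q i, hInv d q i, h_mul_hInv i, hInv_mul_h i⟩

theorem commute_hUnit {i j : Fin n} (hij : i ≠ j) : Commute (hUnit d q i) (hUnit d q j) :=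
  Units.ext (commute_h_h hij)

theorem pairwise_commute_zpowersHom : Pairwise fun i j : Fin n => ∀ a b,
    Commute (zpowersHom _ (hUnit d q i) a) (zpowersHom _ (hUnit d q j) b) :=
  fun _ _ hij _ _ => (commute_hUnit hij).zpow_zpow _ _

/-- The monomials `h^a` as a homomorphism into the unit group. -/
noncomputable def hMonomial (d : ℕ) (q : Kˣ) :
    Multiplicative (Fin n → ℤ) →* (QwaAlgebra d (fun _ : Fin n => q))ˣ :=
  (MonoidHom.noncommPiCoprod (fun i => zpowersHom _ (hUnit d q i))
    pairwise_commute_zpowersHom).comp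
    (MulEquiv.piMultiplicative (fun _ : Fin n => ℤ)).toMonoidHom

theorem hMonomial_single (i : Fin n) :
    hMonomial d q (Multiplicative.ofAdd (Pi.single i 1)) = hUnit d q i := by
  have : (MulEquiv.piMultiplicative (fun _ : Fin n => ℤ))
      (Multiplicative.ofAdd (Pi.single i 1)) = Pi.mulSingle i (Multiplicative.ofAdd 1) := by
    funext j
    by_cases hj : j = i
    · subst hj; simp
    · simp [hj]
  simp only [hMonomial, MonoidHom.comp_apply, MulEquiv.coe_toMonoidHom, this]
  rw [MonoidHom.noncommPiCoprod_mulSingle]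
  simp

/-- The embedding of the Laurent algebra. -/
noncomputable def ofLaurent (d : ℕ) (q : Kˣ) :
    LaurentAlg K n →ₐ[K] QwaAlgebra d (fun _ : Fin n => q) :=
  AddMonoidAlgebra.lift K _ (Fin n → ℤ) ((Units.coeHom _).comp (hMonomial d q))

theorem ofLaurent_single (a : Fin n → ℤ) (c : K) :
    ofLaurent d q (AddMonoidAlgebra.single a c)
      = c • (hMonomial d q (Multiplicative.ofAdd a) : QwaAlgebra d (fun _ : Fin n => q)) := by
  rw [ofLaurent, AddMonoidAlgebra.lift_single]
  rfl

theorem ofLaurent_h (i : Fin n) :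
    ofLaurent d q (AddMonoidAlgebra.single (Pi.single i 1) 1) = h d q i := by
  rw [ofLaurent_single, hMonomial_single, one_smul]
  rfl

theorem ofLaurent_hInv (i : Fin n) :
    ofLaurent d q (AddMonoidAlgebra.single (-Pi.single i 1) 1) = hInv d q i := by
  rw [ofLaurent_single, ofAdd_neg, map_inv, hMonomial_single, one_smul]
  rfl

theorem mem_addSubgroup_of_single_mem {S : AddSubgroup (Fin n → ℤ)}
    (hS : ∀ i, Pi.single i 1 ∈ S) (a : Fin n → ℤ) : a ∈ S := by
  rw [← Finset.univ_sum_single a]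
  refine S.sum_mem fun i _ => ?_
  have := S.zsmul_mem (hS i) (a i)
  rwa [← Pi.single_smul, smul_eq_mul, mul_one] at this

/-- An element that commutes with the `h_i` up to the scalars prescribed by `β` moves past the
Laurent algebra by the shift `σ^β`. -/
theorem mul_ofLaurent_of_mul_h {z : QwaAlgebra d (fun _ : Fin n => q)} {β : Fin n → ℤ}
    (hz : ∀ i, z * h d q i = ((q ^ β i : Kˣ) : K) • (h d q i * z)) (f : LaurentAlg K n) :
    z * ofLaurent d q f = ofLaurent d q (shift q β f) * z := by
  let S : AddSubgroup (Fin n → ℤ) :=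
    { carrier := {a | z * (hMonomial d q (Multiplicative.ofAdd a) : QwaAlgebra d _)
        = ((q ^ (β ⬝ᵥ a) : Kˣ) : K) • ((hMonomial d q (Multiplicative.ofAdd a) : QwaAlgebra d _) * z)}
      zero_mem' := by simp
      add_mem' := by
        intro a b ha hb
        simp only [Set.mem_ofPred_eq] at ha hb ⊢
        rw [ofAdd_add, map_mul, Units.val_mul, ← mul_assoc, ha, smul_mul_assoc, mul_assoc, hb,
          mul_smul_comm, smul_smul, dotProduct_add, zpow_add, Units.val_mul, mul_assoc]
      neg_mem' := by
        intro a ha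
        simp only [Set.mem_ofPred_eq] at ha ⊢
        rw [ofAdd_neg, map_inv, dotProduct_neg, zpow_neg]
        set u := hMonomial d q (Multiplicative.ofAdd a)
        set c := q ^ (β ⬝ᵥ a)
        rw [Units.mul_inv_eq_iff_eq_mul, smul_mul_assoc, mul_assoc, ha, mul_smul_comm, smul_smul,
          Units.inv_mul, one_smul, Units.inv_mul_cancel_left] }
  have hS : ∀ a, a ∈ S := mem_addSubgroup_of_single_mem fun i => by
    change z * _ = _
    rw [hMonomial_single, dotProduct_single, mul_one]
    exact hz i
  induction f using AddMonoidAlgebra.induction_linear with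
  | zero => simp
  | add f g hf hg => simp only [map_add, mul_add, add_mul, hf, hg]
  | single a c =>
    rw [shift_single, ofLaurent_single, ofLaurent_single, mul_smul_comm, hS a, smul_smul,
      smul_mul_assoc]

theorem x_mul_ofLaurent (j : Fin n) (f : LaurentAlg K n) :
    x d q j * ofLaurent d q f = ofLaurent d q (shift q (Pi.single j 1) f) * x d q j := by
  refine mul_ofLaurent_of_mul_h (fun i => ?_) f
  by_cases hij : i = j
  · subst hij
    simpa using x_mul_h i
  · simpa [hij] using (commute_h_x hij).symm.eq

theorem y_mul_ofLaurent (j : Fin n) (f : LaurentAlg K n) :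
    y d q j * ofLaurent d q f = ofLaurent d q (shift q (-Pi.single j 1) f) * y d q j := by
  refine mul_ofLaurent_of_mul_h (fun i => ?_) f
  by_cases hij : i = j
  · subst hij
    simpa using y_mul_h i
  · simpa [hij] using (commute_h_y hij).symm.eq

theorem ofLaurent_pow_sub_one (j : Fin n) :
    ofLaurent d q (binom (Pi.single j (d : ℤ)) 1) = h d q j ^ d - 1 := by
  rw [binom, map_sub, map_one, ← ofLaurent_h, ← map_pow, AddMonoidAlgebra.single_pow, one_pow,
    ← Pi.single_smul]
  simp

theorem y_mul_x_eq (j : Fin n) :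
    y d q j * x d q j = ofLaurent d q (binom (Pi.single j (d : ℤ)) 1) := by
  rw [ofLaurent_pow_sub_one, y_mul_x]

theorem x_mul_y_eq (j : Fin n) :
    x d q j * y d q j
      = ofLaurent d q (shift q (Pi.single j 1) (binom (Pi.single j (d : ℤ)) 1)) := by
  rw [x_mul_y, shift_binom, binom, map_sub, map_one, ofLaurent_single, smul_pow]
  have := ofLaurent_pow_sub_one (d := d) (q := q) j
  rw [binom, map_sub, map_one, sub_left_inj, ofLaurent_single, one_smul] at this
  rw [this]
  simp

/-! ### Monomials in the `x_j`, `y_j` and the spanning property -/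

/-- The `m`-th power of `x_j`, where negative powers stand for powers of `y_j`. -/
noncomputable def xPow (d : ℕ) (q : Kˣ) (j : Fin n) (m : ℤ) : QwaAlgebra d (fun _ : Fin n => q) :=
  x d q j ^ m.toNat * y d q j ^ (-m).toNat

theorem xPow_natCast (j : Fin n) (m : ℕ) : xPow d q j m = x d q j ^ m := by
  simp [xPow]

theorem xPow_neg_natCast (j : Fin n) (m : ℕ) : xPow d q j (-m) = y d q j ^ m := by
  simp [xPow]

theorem exists_x_mul_xPow (j : Fin n) (m : ℤ) :
    ∃ p, x d q j * xPow d q j m = ofLaurent d q p * xPow d q j (m + 1) := by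
  obtain ⟨k, rfl | rfl⟩ := m.eq_nat_or_neg
  · refine ⟨1, ?_⟩
    rw [map_one, one_mul, xPow_natCast, ← pow_succ', ← xPow_natCast, Nat.cast_succ]
  · cases k with
    | zero =>
      refine ⟨1, ?_⟩
      simp [xPow]
    | succ k =>
      refine ⟨shift q (Pi.single j 1) (binom (Pi.single j (d : ℤ)) 1), ?_⟩
      rw [xPow_neg_natCast, pow_succ', ← mul_assoc, x_mul_y_eq, ← xPow_neg_natCast]
      congr 2
      push_cast
      ring

theorem exists_y_mul_xPow (j : Fin n) (m : ℤ) :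
    ∃ p, y d q j * xPow d q j m = ofLaurent d q p * xPow d q j (m - 1) := by
  obtain ⟨k, rfl | rfl⟩ := m.eq_nat_or_neg
  · cases k with
    | zero =>
      refine ⟨1, ?_⟩
      simp [xPow]
    | succ k =>
      refine ⟨binom (Pi.single j (d : ℤ)) 1, ?_⟩
      rw [xPow_natCast, pow_succ', ← mul_assoc, y_mul_x_eq, ← xPow_natCast]
      congr 2
      push_cast
      ring
  · refine ⟨1, ?_⟩
    rw [map_one, one_mul, xPow_neg_natCast, ← pow_succ', ← xPow_neg_natCast]
    congr 1
    push_cast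
    ring

theorem commute_xPow {i j : Fin n} (hij : i ≠ j) (a b : ℤ) :
    Commute (xPow d q i a) (xPow d q j b) :=
  (((commute_x_x hij).pow_pow _ _).mul_right ((commute_x_y hij).pow_pow _ _)).mul_left
    (((commute_x_y hij.symm).symm.pow_pow _ _).mul_right ((commute_y_y hij).pow_pow _ _))

theorem pairwise_commute_xPow (β : Fin n → ℤ) (s : Set (Fin n)) :
    s.Pairwise (Function.onFun Commute fun j => xPow d q j (β j)) :=
  fun _ _ _ _ hij => commute_xPow hij _ _

/-- The product of the powers `x_j ^ β_j` over a finite set of indices `j`. -/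
noncomputable def xProd (d : ℕ) (q : Kˣ) (s : Finset (Fin n)) (β : Fin n → ℤ) :
    QwaAlgebra d (fun _ : Fin n => q) :=
  s.noncommProd (fun j => xPow d q j (β j)) (pairwise_commute_xPow β _)

theorem xProd_empty (β : Fin n → ℤ) : xProd d q ∅ β = 1 := Finset.noncommProd_empty _ _

theorem xProd_insert {s : Finset (Fin n)} {j : Fin n} (hj : j ∉ s) (β : Fin n → ℤ) :
    xProd d q (insert j s) β = xPow d q j (β j) * xProd d q s β :=
  Finset.noncommProd_insert_of_notMem _ _ _ _ hj

theorem xProd_zero (s : Finset (Fin n)) : xProd d q s 0 = 1 := by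
  induction s using Finset.induction_on with
  | empty => exact xProd_empty _
  | insert j s hj ih => rw [xProd_insert hj, ih]; simp [xPow]

theorem xProd_congr {s : Finset (Fin n)} {β γ : Fin n → ℤ} (h : ∀ j ∈ s, β j = γ j) :
    xProd d q s β = xProd d q s γ :=
  Finset.noncommProd_congr rfl (fun j hj => by rw [h j hj]) _

theorem xProd_univ (j : Fin n) (β : Fin n → ℤ) :
    xProd d q Finset.univ β = xPow d q j (β j) * xProd d q (Finset.univ.erase j) β := by
  rw [← xProd_insert (Finset.notMem_erase j _), Finset.insert_erase (Finset.mem_univ j)]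

theorem exists_x_mul_xProd (j : Fin n) (β : Fin n → ℤ) :
    ∃ p, x d q j * xProd d q Finset.univ β
      = ofLaurent d q p * xProd d q Finset.univ (β + Pi.single j 1) := by
  obtain ⟨p, hp⟩ := exists_x_mul_xPow (d := d) (q := q) j (β j)
  refine ⟨p, ?_⟩
  rw [xProd_univ j, xProd_univ j, ← mul_assoc, hp, mul_assoc]
  congr 2
  · simp
  · refine xProd_congr fun i hi => ?_
    simp [Finset.ne_of_mem_erase hi]

theorem exists_y_mul_xProd (j : Fin n) (β : Fin n → ℤ) :
    ∃ p, y d q j * xProd d q Finset.univ β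
      = ofLaurent d q p * xProd d q Finset.univ (β - Pi.single j 1) := by
  obtain ⟨p, hp⟩ := exists_y_mul_xPow (d := d) (q := q) j (β j)
  refine ⟨p, ?_⟩
  rw [xProd_univ j, xProd_univ j, ← mul_assoc, hp, mul_assoc]
  congr 2
  · simp
  · refine xProd_congr fun i hi => ?_
    simp [Finset.ne_of_mem_erase hi]

/-- The additive map sending a family of Laurent polynomials to the corresponding combination
of the monomials `x^β`. -/
noncomputable def ofFinsupp (d : ℕ) (q : Kˣ) :
    ((Fin n → ℤ) →₀ LaurentAlg K n) →+ QwaAlgebra d (fun _ : Fin n => q) :=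
  Finsupp.liftAddHom fun β =>
    (AddMonoidHom.mulRight (xProd d q Finset.univ β)).comp (ofLaurent d q).toRingHom.toAddMonoidHom

theorem ofFinsupp_single (β : Fin n → ℤ) (f : LaurentAlg K n) :
    ofFinsupp d q (Finsupp.single β f) = ofLaurent d q f * xProd d q Finset.univ β := by
  simp [ofFinsupp]

theorem ofFinsupp_apply (F : (Fin n → ℤ) →₀ LaurentAlg K n) :
    ofFinsupp d q F = ∑ β ∈ F.support, ofLaurent d q (F β) * xProd d q Finset.univ β := by
  simp [ofFinsupp, Finsupp.sum]

theorem mul_mem_range_ofFinsupp {z : QwaAlgebra d (fun _ : Fin n => q)}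
    (hz : ∀ β f, z * (ofLaurent d q f * xProd d q Finset.univ β) ∈ (ofFinsupp d q).range)
    {b : QwaAlgebra d (fun _ : Fin n => q)} (hb : b ∈ (ofFinsupp d q).range) :
    z * b ∈ (ofFinsupp d q).range := by
  obtain ⟨F, rfl⟩ := hb
  rw [ofFinsupp_apply, Finset.mul_sum]
  exact sum_mem fun β _ => hz β _

theorem ofLaurent_mul_mem_range (β : Fin n → ℤ) (f : LaurentAlg K n) :
    ofLaurent d q f * xProd d q Finset.univ β ∈ (ofFinsupp d q).range :=
  ⟨Finsupp.single β f, ofFinsupp_single β f⟩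

/-- The range contains `1` and is stable under left multiplication by the generators, since those
move past Laurent coefficients by a shift and raise or lower one exponent. The elements preserving
it form a subalgebra, hence everything. -/
theorem ofFinsupp_surjective : Function.Surjective (ofFinsupp (n := n) d q) := by
  have hL : ∀ g : LaurentAlg K n, ∀ b ∈ (ofFinsupp d q).range,
      ofLaurent d q g * b ∈ (ofFinsupp d q).range := fun g b hb =>
    mul_mem_range_ofFinsupp (fun β f => by
      rw [← mul_assoc, ← map_mul]
      exact ofLaurent_mul_mem_range _ _) hb
  let S : Subalgebra K (QwaAlgebra d (fun _ : Fin n => q)) :=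
    { carrier := {a | ∀ b ∈ (ofFinsupp d q).range, a * b ∈ (ofFinsupp d q).range}
      mul_mem' := by
        intro a b ha hb c hc
        rw [mul_assoc]
        exact ha _ (hb _ hc)
      add_mem' := by
        intro a b ha hb c hc
        rw [add_mul]
        exact add_mem (ha _ hc) (hb _ hc)
      algebraMap_mem' := by
        intro r b hb
        rw [← (ofLaurent d q).commutes]
        exact hL _ b hb }
  have hS : S = ⊤ := by
    refine subalgebra_eq_top (fun i b hb => mul_mem_range_ofFinsupp (fun β f => ?_) hb)
      (fun i b hb => mul_mem_range_ofFinsupp (fun β f => ?_) hb) (fun i => ?_) (fun i => ?_)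
    · obtain ⟨p, hp⟩ := exists_x_mul_xProd (d := d) (q := q) i β
      rw [← mul_assoc, x_mul_ofLaurent, mul_assoc, hp, ← mul_assoc, ← map_mul]
      exact ofLaurent_mul_mem_range _ _
    · obtain ⟨p, hp⟩ := exists_y_mul_xProd (d := d) (q := q) i β
      rw [← mul_assoc, y_mul_ofLaurent, mul_assoc, hp, ← mul_assoc, ← map_mul]
      exact ofLaurent_mul_mem_range _ _
    · rw [← ofLaurent_h]
      exact hL _
    · rw [← ofLaurent_hInv]
      exact hL _
  intro a
  have ha : a ∈ S := hS ▸ Algebra.mem_top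
  have h1 : (1 : QwaAlgebra d (fun _ : Fin n => q)) ∈ (ofFinsupp d q).range := by
    have := ofLaurent_mul_mem_range (d := d) (q := q) (0 : Fin n → ℤ) 1
    rwa [map_one, one_mul, xProd_zero] at this
  simpa using ha 1 h1

/-! ### Embedding into the quantum torus -/

/-- The images of the generators in the quantum torus. -/
noncomputable def genToTorus (d : ℕ) (q : Kˣ) : QwaGen n → QTorus q n
  | .x i => mono q (Pi.single i 1) 1
  | .y i => mono q (-Pi.single i 1) (binom (Pi.single i (d : ℤ)) 1)
  | .h i => mono q 0 (AddMonoidAlgebra.single (Pi.single i 1) 1)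
  | .hInv i => mono q 0 (AddMonoidAlgebra.single (-Pi.single i 1) 1)

theorem single_single_pow (i : Fin n) (c : K) :
    (AddMonoidAlgebra.single (Pi.single i 1) c : LaurentAlg K n) ^ d
      = AddMonoidAlgebra.single (Pi.single i (d : ℤ)) (c ^ d) := by
  rw [AddMonoidAlgebra.single_pow, ← Pi.single_smul]
  simp

theorem genToTorus_rel {a b : FreeAlgebra K (QwaGen n)}
    (hab : Qwa.Rel d (fun _ : Fin n => q) a b) :
    FreeAlgebra.lift K (genToTorus d q) a = FreeAlgebra.lift K (genToTorus d q) b := by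
  induction hab with
  | x_h i =>
    simp [genToTorus, mono_mul_mono, shift_single, smul_mono, AddMonoidAlgebra.smul_single]
  | y_h i =>
    simp only [genToTorus, map_mul, map_smul, FreeAlgebra.lift_ι_apply, mono_mul_mono,
      shift_single, shift_zero, add_zero, zero_add, smul_mono]
    rw [mul_comm, ← smul_mul_assoc, AddMonoidAlgebra.smul_single]
    simp
  | x_y i =>
    simp only [genToTorus, map_mul, map_sub, map_pow, map_smul, map_one, FreeAlgebra.lift_ι_apply,
      mono_mul_mono, add_neg_cancel, one_mul, shift_binom, smul_mono, mono_zero_pow,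
      AddMonoidAlgebra.smul_single, single_single_pow, ← mono_zero_one, ← mono_sub]
    simp [binom]
  | y_x i =>
    simp only [genToTorus, map_mul, map_sub, map_pow, map_one, FreeAlgebra.lift_ι_apply,
      mono_mul_mono, neg_add_cancel, mul_one, mono_zero_pow, single_single_pow,
      ← mono_zero_one, ← mono_sub, binom, one_pow]
  | h_hInv i =>
    simp [genToTorus, mono_mul_mono, shift_zero, AddMonoidAlgebra.single_mul_single,
      ← AddMonoidAlgebra.one_def, mono_zero_one]
  | hInv_h i =>
    simp [genToTorus, mono_mul_mono, shift_zero, AddMonoidAlgebra.single_mul_single,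
      ← AddMonoidAlgebra.one_def, mono_zero_one]
  | comm_h_h i j hij =>
    simp [genToTorus, mono_mul_mono, shift_zero, mul_comm]
  | comm_h_x i j hij =>
    simp [genToTorus, mono_mul_mono, shift_single, hij]
  | comm_h_y i j hij =>
    simp [genToTorus, mono_mul_mono, shift_single, shift_zero, hij, mul_comm]
  | comm_x_x i j hij =>
    simp [genToTorus, mono_mul_mono, add_comm]
  | comm_x_y i j hij =>
    simp [genToTorus, mono_mul_mono, shift_binom, hij.symm, add_comm]
  | comm_y_y i j hij =>
    simp [genToTorus, mono_mul_mono, shift_binom, hij, hij.symm, add_comm, mul_comm]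

/-- The homomorphism into the quantum torus sending `y_i` to `(h_i^d - 1) x_i⁻¹`. -/
noncomputable def toTorus (d : ℕ) (q : Kˣ) :
    QwaAlgebra d (fun _ : Fin n => q) →ₐ[K] QTorus q n :=
  RingQuot.liftAlgHom K ⟨FreeAlgebra.lift K (genToTorus d q), fun _ _ h => genToTorus_rel h⟩

theorem toTorus_x (i : Fin n) : toTorus d q (x d q i) = mono q (Pi.single i 1) 1 := by
  simp [toTorus, x, genToTorus]

theorem toTorus_y (i : Fin n) :
    toTorus d q (y d q i) = mono q (-Pi.single i 1) (binom (Pi.single i (d : ℤ)) 1) := by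
  simp [toTorus, y, genToTorus]

theorem toTorus_h (i : Fin n) :
    toTorus d q (h d q i) = mono q 0 (AddMonoidAlgebra.single (Pi.single i 1) 1) := by
  simp [toTorus, h, genToTorus]

theorem toTorus_hMonomial (a : Fin n → ℤ) :
    toTorus d q (hMonomial d q (Multiplicative.ofAdd a) : QwaAlgebra d (fun _ : Fin n => q))
      = mono q 0 (AddMonoidAlgebra.single a 1) := by
  let S : AddSubgroup (Fin n → ℤ) :=
    { carrier := {a | toTorus d q (hMonomial d q (Multiplicative.ofAdd a) :
        QwaAlgebra d (fun _ : Fin n => q)) = mono q 0 (AddMonoidAlgebra.single a 1)}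
      zero_mem' := by
        simp [← AddMonoidAlgebra.one_def, mono_zero_one]
      add_mem' := by
        intro a b ha hb
        simp only [Set.mem_ofPred_eq] at ha hb ⊢
        rw [ofAdd_add, map_mul, Units.val_mul, map_mul, ha, hb, mono_mul_mono, shift_zero,
          AddMonoidAlgebra.single_mul_single, add_zero, one_mul]
      neg_mem' := by
        intro a ha
        simp only [Set.mem_ofPred_eq] at ha ⊢
        have h1 : mono q 0 (AddMonoidAlgebra.single (-a) 1) * toTorus d q
            (hMonomial d q (Multiplicative.ofAdd a) : QwaAlgebra d (fun _ : Fin n => q)) = 1 := by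
          rw [ha, mono_mul_mono, shift_zero, AddMonoidAlgebra.single_mul_single, neg_add_cancel,
            mul_one, add_zero, ← AddMonoidAlgebra.one_def, mono_zero_one]
        have h2 : toTorus d q (hMonomial d q (Multiplicative.ofAdd a) :
              QwaAlgebra d (fun _ : Fin n => q)) *
            toTorus d q (hMonomial d q (Multiplicative.ofAdd (-a)) :
              QwaAlgebra d (fun _ : Fin n => q)) = 1 := by
          rw [← map_mul, ofAdd_neg, map_inv, Units.mul_inv, map_one]
        exact (left_inv_eq_right_inv h1 h2).symm }
  have hS : ∀ a, a ∈ S := mem_addSubgroup_of_single_mem fun i => by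
    change toTorus d q _ = _
    rw [hMonomial_single]
    exact toTorus_h i
  exact hS a

theorem toTorus_ofLaurent (f : LaurentAlg K n) : toTorus d q (ofLaurent d q f) = mono q 0 f := by
  induction f using AddMonoidAlgebra.induction_linear with
  | zero => simp [mono_zero_right]
  | add f g hf hg => rw [map_add, map_add, hf, hg, mono_add]
  | single a c =>
    rw [ofLaurent_single, map_smul, toTorus_hMonomial, smul_mono, AddMonoidAlgebra.smul_single,
      smul_eq_mul, mul_one]

theorem toTorus_x_pow (j : Fin n) (m : ℕ) :
    toTorus d q (x d q j ^ m) = mono q (Pi.single j (m : ℤ)) 1 := by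
  induction m with
  | zero => simp [mono_zero_one]
  | succ m ih => rw [pow_succ, map_mul, ih, toTorus_x, mono_mul_mono, map_one, mul_one,
      ← Pi.single_add, Nat.cast_succ]

theorem exists_toTorus_y_pow (hd : 1 ≤ d) (j : Fin n) (m : ℕ) :
    ∃ p, p ≠ 0 ∧ (0 < m → binom (Pi.single j (d : ℤ)) 1 ∣ p) ∧
      toTorus d q (y d q j ^ m) = mono q (Pi.single j (-(m : ℤ))) p := by
  induction m with
  | zero => exact ⟨1, one_ne_zero, by simp, by simp [mono_zero_one]⟩
  | succ m ih =>
    obtain ⟨p, hp, -, h⟩ := ih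
    have hne : (Pi.single j (d : ℤ) : Fin n → ℤ) ≠ 0 := by
      rw [Ne, Pi.single_eq_zero_iff]
      exact_mod_cast (Nat.one_le_iff_ne_zero.1 hd)
    refine ⟨binom (Pi.single j (d : ℤ)) 1 * shift q (-Pi.single j 1) p,
      mul_ne_zero (binom_ne_zero hne 1) ?_, fun _ => dvd_mul_right _ _, ?_⟩
    · rwa [Ne, map_eq_zero_iff _ (shift_injective q _)]
    · rw [pow_succ', map_mul, h, toTorus_y, mono_mul_mono, ← Pi.single_neg, ← Pi.single_add]
      congr 2
      push_cast
      ring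

theorem exists_toTorus_xPow (hd : 1 ≤ d) (j : Fin n) (m : ℤ) :
    ∃ p, p ≠ 0 ∧ (m < 0 → binom (Pi.single j (d : ℤ)) 1 ∣ p) ∧
      toTorus d q (xPow d q j m) = mono q (Pi.single j m) p := by
  obtain ⟨k, rfl | rfl⟩ := m.eq_nat_or_neg
  · exact ⟨1, one_ne_zero, by omega, by rw [xPow_natCast, toTorus_x_pow]⟩
  · obtain ⟨p, hp, hdvd, h⟩ := exists_toTorus_y_pow (q := q) hd j k
    exact ⟨p, hp, fun hk => hdvd (by omega), by rw [xPow_neg_natCast, h]⟩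

theorem exists_toTorus_xProd (hd : 1 ≤ d) (β : Fin n → ℤ) :
    ∃ p, p ≠ 0 ∧ (∀ j, β j < 0 → binom (Pi.single j (d : ℤ)) 1 ∣ p) ∧
      toTorus d q (xProd d q Finset.univ β) = mono q β p := by
  have key : ∀ s : Finset (Fin n), ∃ p, p ≠ 0 ∧
      (∀ j ∈ s, β j < 0 → binom (Pi.single j (d : ℤ)) 1 ∣ p) ∧
      toTorus d q (xProd d q s β) = mono q (∑ j ∈ s, Pi.single j (β j)) p := by
    intro s
    induction s using Finset.induction_on with
    | empty =>
      refine ⟨1, one_ne_zero, by simp, ?_⟩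
      rw [xProd_empty, map_one, Finset.sum_empty, mono_zero_one]
    | insert i s hi ih =>
      obtain ⟨p, hp, hdvd, h⟩ := ih
      obtain ⟨r, hr, hrdvd, h'⟩ := exists_toTorus_xPow (q := q) hd i (β i)
      refine ⟨r * shift q (Pi.single i (β i)) p, mul_ne_zero hr ?_, fun j hj hβ => ?_, ?_⟩
      · rwa [Ne, map_eq_zero_iff _ (shift_injective q _)]
      · rcases Finset.mem_insert.1 hj with rfl | hjs
        · exact (hrdvd hβ).mul_right _
        · have hij : j ≠ i := fun hji => hi (hji ▸ hjs)
          -- The shift in direction `i` fixes `h_j^d - 1`, so divisibility survives moving the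
          -- coefficient past the new factor.
          have := map_dvd (shift q (Pi.single i (β i))) (hdvd j hjs hβ)
          rw [shift_binom] at this
          refine Dvd.dvd.mul_left ?_ _
          simpa [hij, hij.symm] using this
      · rw [xProd_insert hi, map_mul, h, h', mono_mul_mono, Finset.sum_insert hi]
  obtain ⟨p, hp, hdvd, h⟩ := key Finset.univ
  rw [Finset.univ_sum_single] at h
  exact ⟨p, hp, fun j => hdvd j (Finset.mem_univ j), h⟩

/-- Each `x^β` has a homogeneous image with nonzero coefficient `p`, and distinct `β` occupy
distinct degrees. Nonvanishing of `p` yields injectivity of `toTorus`; its divisors yield the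
constraint on negative degrees. -/
theorem exists_comp_toTorus_ofFinsupp (hd : 1 ≤ d) (β : Fin n → ℤ) :
    ∃ p : LaurentAlg K n, p ≠ 0 ∧ (∀ j, β j < 0 → binom (Pi.single j (d : ℤ)) 1 ∣ p) ∧
      ∀ F, comp (toTorus d q (ofFinsupp d q F)) β = F β * p := by
  obtain ⟨p, hp, hdvd, h⟩ := exists_toTorus_xProd (q := q) hd β
  refine ⟨p, hp, hdvd, fun F => ?_⟩
  induction F using Finsupp.induction_linear with
  | zero => simp [comp_zero]
  | add F G hF hG => simp only [map_add, comp_add, hF, hG, Finsupp.add_apply, add_mul]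
  | single γ f =>
    rw [ofFinsupp_single, map_mul, toTorus_ofLaurent, comp_mono_zero_mul]
    by_cases hγ : β = γ
    · subst hγ
      rw [h, comp_mono_self, Finsupp.single_eq_same]
    · obtain ⟨p', -, -, h'⟩ := exists_toTorus_xProd (q := q) hd γ
      rw [h', comp_mono_of_ne hγ, Finsupp.single_eq_of_ne hγ, mul_zero, zero_mul]

theorem toTorus_injective (hd : 1 ≤ d) : Function.Injective (toTorus (n := n) d q) := by
  rw [injective_iff_map_eq_zero]
  intro a ha
  obtain ⟨F, rfl⟩ := ofFinsupp_surjective a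
  have : F = 0 := by
    ext1 β
    obtain ⟨p, hp, -, h⟩ := exists_comp_toTorus_ofFinsupp (q := q) hd β
    have h1 := h F
    rw [ha, comp_zero] at h1
    exact (mul_eq_zero.1 h1.symm).resolve_right hp
  rw [this, map_zero]

/-! ### Divisibility constraints and units of the algebra -/

/-- The components of degree `β` of elements of the algebra are divisible by `h_j^d - 1`
whenever `β_j` is negative. -/
theorem binom_dvd_comp_toTorus (hd : 1 ≤ d) (a : QwaAlgebra d (fun _ : Fin n => q))
    {β : Fin n → ℤ} {j : Fin n} (hβ : β j < 0) :
    binom (Pi.single j (d : ℤ)) 1 ∣ comp (toTorus d q a) β := by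
  obtain ⟨F, rfl⟩ := ofFinsupp_surjective a
  obtain ⟨p, -, hdvd, h⟩ := exists_comp_toTorus_ofFinsupp (q := q) hd β
  rw [h F]
  exact (hdvd j hβ).mul_left _

theorem single_natCast_ne_zero (hd : 1 ≤ d) (j : Fin n) :
    (Pi.single j (d : ℤ) : Fin n → ℤ) ≠ 0 := by
  rw [Ne, Pi.single_eq_zero_iff]
  exact_mod_cast (Nat.one_le_iff_ne_zero.1 hd)

/-- Units of the algebra are scalar multiples of the monomials `h^a`. -/
theorem exists_toTorus_eq_of_mul_eq_one (hd : 1 ≤ d) {u v : QwaAlgebra d (fun _ : Fin n => q)}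
    (h : u * v = 1) :
    ∃ (a : Fin n → ℤ) (c : K), c ≠ 0 ∧ toTorus d q u = mono q 0 (AddMonoidAlgebra.single a c) := by
  have h1 : toTorus d q u * toTorus d q v = 1 := by rw [← map_mul, h, map_one]
  obtain ⟨β, f, g, hf, hg, hfg⟩ := exists_eq_mono_of_mul_eq_one h1
  have hfu : IsUnit f := IsUnit.of_mul_eq_one _ hfg
  have hgu : IsUnit g := isUnit_of_isUnit_shift (IsUnit.of_mul_eq_one_right _ hfg)
  -- A negative `β_j` makes a non-unit binomial divide the coefficient of `u`; a positive one does
  -- the same to the inverse, whose degree is `-β`.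
  have hβ : β = 0 := by
    funext j
    rw [Pi.zero_apply]
    by_contra hj
    rcases lt_or_gt_of_ne hj with hj | hj
    · have := binom_dvd_comp_toTorus hd u hj
      rw [hf, comp_mono_self] at this
      exact not_isUnit_binom (single_natCast_ne_zero hd j) one_ne_zero (isUnit_of_dvd_unit this hfu)
    · have := binom_dvd_comp_toTorus hd v (β := -β) (j := j) (by simpa using hj)
      rw [hg, comp_mono_self] at this
      exact not_isUnit_binom (single_natCast_ne_zero hd j) one_ne_zero (isUnit_of_dvd_unit this hgu)
  obtain ⟨a, c, hc, rfl⟩ := exists_eq_single_of_isUnit hfu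
  exact ⟨a, c, hc, by rw [hf, hβ]⟩

theorem xProd_mul_h (hd : 1 ≤ d) (β : Fin n → ℤ) (i : Fin n) :
    xProd d q Finset.univ β * h d q i
      = ((q ^ β i : Kˣ) : K) • (h d q i * xProd d q Finset.univ β) := by
  obtain ⟨p, -, -, hp⟩ := exists_toTorus_xProd (q := q) hd β
  apply toTorus_injective hd
  rw [map_mul, map_smul, map_mul, hp, toTorus_h, mono_mul_mono, mono_mul_mono, shift_single,
    shift_zero, smul_mono, add_zero, zero_add, mul_comm p, ← smul_mul_assoc,
    AddMonoidAlgebra.smul_single]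
  simp

/-- Products of opposite homogeneous elements lie in the Laurent algebra. -/
theorem exists_mul_xProd_neg (hd : 1 ≤ d) (β : Fin n → ℤ) :
    ∃ r : LaurentAlg K n, r ≠ 0 ∧
      xProd d q Finset.univ β * xProd d q Finset.univ (-β) = ofLaurent d q r := by
  obtain ⟨p, hp0, -, hp⟩ := exists_toTorus_xProd (q := q) hd β
  obtain ⟨p', hp0', -, hp'⟩ := exists_toTorus_xProd (q := q) hd (-β)
  refine ⟨p * shift q β p', mul_ne_zero hp0 ?_, toTorus_injective hd ?_⟩
  · rwa [Ne, map_eq_zero_iff _ (shift_injective q _)]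
  · rw [map_mul, hp, hp', mono_mul_mono, toTorus_ofLaurent, add_neg_cancel]

theorem ofLaurent_mem {S : Subalgebra K (QwaAlgebra d (fun _ : Fin n => q))}
    (hh : ∀ i, h d q i ∈ S) (hi : ∀ i, hInv d q i ∈ S) (f : LaurentAlg K n) :
    ofLaurent d q f ∈ S := by
  let T : AddSubgroup (Fin n → ℤ) :=
    { carrier := {a | ofLaurent d q (AddMonoidAlgebra.single a 1) ∈ S ∧
        ofLaurent d q (AddMonoidAlgebra.single (-a) 1) ∈ S}
      zero_mem' := by
        simp [← AddMonoidAlgebra.one_def, S.one_mem]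
      add_mem' := by
        intro a b ha hb
        have h1 : ∀ a b : Fin n → ℤ, (AddMonoidAlgebra.single (a + b) 1 : LaurentAlg K n)
            = AddMonoidAlgebra.single a 1 * AddMonoidAlgebra.single b 1 := by
          intro a b
          rw [AddMonoidAlgebra.single_mul_single, mul_one]
        refine ⟨?_, ?_⟩
        · rw [h1, map_mul]
          exact S.mul_mem ha.1 hb.1
        · rw [neg_add, h1, map_mul]
          exact S.mul_mem ha.2 hb.2
      neg_mem' := fun {a} ha => ⟨ha.2, (neg_neg a).symm ▸ ha.1⟩ }
  have hT : ∀ a, a ∈ T := mem_addSubgroup_of_single_mem fun i =>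
    ⟨(ofLaurent_h (d := d) (q := q) i).symm ▸ hh i,
      (ofLaurent_hInv (d := d) (q := q) i).symm ▸ hi i⟩
  induction f using AddMonoidAlgebra.induction_linear with
  | zero => rw [map_zero]; exact S.zero_mem
  | add f g hf hg => rw [map_add]; exact S.add_mem hf hg
  | single a c =>
    have : (AddMonoidAlgebra.single a c : LaurentAlg K n) = c • AddMonoidAlgebra.single a 1 := by
      rw [AddMonoidAlgebra.smul_single, smul_eq_mul, mul_one]
    rw [this, map_smul]
    exact S.smul_mem (hT a).1 c

/-! ### The shape of an endomorphism on generators -/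

section Endomorphism

variable {ψ : QwaAlgebra d (fun _ : Fin n => q) →ₐ[K] QwaAlgebra d (fun _ : Fin n => q)}
  {a : Fin n → Fin n → ℤ} {c : Fin n → K}

/-- `ψ` preserves q-commutation with the `h_i`, whose images are monomials, so each degree `γ` in
`ψ(z)` solves the linear system `A γ = β`. -/
theorem dotProduct_eq_of_comp_map_ne_zero (hq : ∀ m : ℕ, 1 ≤ m → q ^ m ≠ 1) (hc : ∀ i, c i ≠ 0)
    (ha : ∀ i, toTorus d q (ψ (h d q i)) = mono q 0 (AddMonoidAlgebra.single (a i) (c i)))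
    {z : QwaAlgebra d (fun _ : Fin n => q)} {β : Fin n → ℤ}
    (hz : ∀ i, z * h d q i = ((q ^ β i : Kˣ) : K) • (h d q i * z)) {γ : Fin n → ℤ}
    (hγ : comp (toTorus d q (ψ z)) γ ≠ 0) (i : Fin n) : a i ⬝ᵥ γ = β i := by
  refine dotProduct_eq_of_comp_ne_zero hq (hc i) ?_ hγ
  rw [← ha, ← map_mul, ← map_mul, ← map_mul, ← map_mul, hz, map_smul, map_smul]

theorem dotProduct_eq_of_comp_map_x (hq : ∀ m : ℕ, 1 ≤ m → q ^ m ≠ 1) (hc : ∀ i, c i ≠ 0)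
    (ha : ∀ i, toTorus d q (ψ (h d q i)) = mono q 0 (AddMonoidAlgebra.single (a i) (c i)))
    {k : Fin n} {γ : Fin n → ℤ} (hγ : comp (toTorus d q (ψ (x d q k))) γ ≠ 0) (i : Fin n) :
    a i ⬝ᵥ γ = (Pi.single k 1 : Fin n → ℤ) i := by
  refine dotProduct_eq_of_comp_map_ne_zero hq hc ha (fun i => ?_) hγ i
  by_cases hik : i = k
  · subst hik
    simpa using x_mul_h i
  · simpa [hik] using (commute_h_x hik).symm.eq

theorem dotProduct_eq_of_comp_map_y (hq : ∀ m : ℕ, 1 ≤ m → q ^ m ≠ 1) (hc : ∀ i, c i ≠ 0)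
    (ha : ∀ i, toTorus d q (ψ (h d q i)) = mono q 0 (AddMonoidAlgebra.single (a i) (c i)))
    {k : Fin n} {γ : Fin n → ℤ} (hγ : comp (toTorus d q (ψ (y d q k))) γ ≠ 0) (i : Fin n) :
    a i ⬝ᵥ γ = (-Pi.single k 1 : Fin n → ℤ) i := by
  refine dotProduct_eq_of_comp_map_ne_zero hq hc ha (fun i => ?_) hγ i
  by_cases hik : i = k
  · subst hik
    simpa using y_mul_h i
  · simpa [hik] using (commute_h_y hik).symm.eq

theorem toTorus_map_x_mul_y
    (ha : ∀ i, toTorus d q (ψ (h d q i)) = mono q 0 (AddMonoidAlgebra.single (a i) (c i)))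
    (i : Fin n) : toTorus d q (ψ (x d q i)) * toTorus d q (ψ (y d q i))
      = mono q 0 (binom (d • a i) (((q : K) * c i) ^ d)) := by
  rw [← map_mul, ← map_mul, x_mul_y, map_sub, map_sub, map_pow, map_pow, map_smul, map_smul, ha,
    smul_mono, AddMonoidAlgebra.smul_single, mono_zero_pow, AddMonoidAlgebra.single_pow, map_one,
    map_one, ← mono_zero_one, ← mono_sub, smul_eq_mul, binom]

theorem toTorus_map_y_mul_x
    (ha : ∀ i, toTorus d q (ψ (h d q i)) = mono q 0 (AddMonoidAlgebra.single (a i) (c i)))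
    (i : Fin n) : toTorus d q (ψ (y d q i)) * toTorus d q (ψ (x d q i))
      = mono q 0 (binom (d • a i) (c i ^ d)) := by
  rw [← map_mul, ← map_mul, y_mul_x, map_sub, map_sub, map_pow, map_pow, ha,
    mono_zero_pow, AddMonoidAlgebra.single_pow, map_one,
    map_one, ← mono_zero_one, ← mono_sub, binom]

/-- If `ψ` killed `x_i` it would kill both `x_i y_i` and `y_i x_i`; comparing their images gives `(q
c_i)^d = c_i^d`, so `q^d = 1`. -/
theorem exists_comp_map_x_ne_zero (hd : 1 ≤ d) (hq : ∀ m : ℕ, 1 ≤ m → q ^ m ≠ 1)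
    (hc : ∀ i, c i ≠ 0)
    (ha : ∀ i, toTorus d q (ψ (h d q i)) = mono q 0 (AddMonoidAlgebra.single (a i) (c i)))
    (i : Fin n) : ∃ γ, comp (toTorus d q (ψ (x d q i))) γ ≠ 0 := by
  by_contra! hx
  have hx0 : toTorus d q (ψ (x d q i)) = 0 := ext_comp hx
  have h1 := toTorus_map_x_mul_y ha i
  have h2 := toTorus_map_y_mul_x ha i
  rw [hx0, zero_mul] at h1
  rw [hx0, mul_zero, h1] at h2
  have h3 := mono_injective _ h2
  rw [binom, binom, sub_left_inj, AddMonoidAlgebra.single_right_inj, mul_pow,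
    mul_eq_right₀ (pow_ne_zero d (hc i))] at h3
  exact hq d hd (Units.ext (by simpa using h3))

/-- The exponents of the images of the `x_i` form a matrix inverse to that of the exponents of
the images of the `h_i`. -/
theorem exists_toTorus_map_eq_mono (hd : 1 ≤ d) (hq : ∀ m : ℕ, 1 ≤ m → q ^ m ≠ 1)
    (hc : ∀ i, c i ≠ 0)
    (ha : ∀ i, toTorus d q (ψ (h d q i)) = mono q 0 (AddMonoidAlgebra.single (a i) (c i))) :
    ∃ (b : Fin n → Fin n → ℤ) (f g : Fin n → LaurentAlg K n),
      (∀ i k, a i ⬝ᵥ b k = (Pi.single k 1 : Fin n → ℤ) i) ∧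
      (∀ i, f i ≠ 0 ∧ toTorus d q (ψ (x d q i)) = mono q (b i) (f i)) ∧
      (∀ i, toTorus d q (ψ (y d q i)) = mono q (-b i) (g i)) := by
  choose b hb using exists_comp_map_x_ne_zero (ψ := ψ) hd hq hc ha
  have hab : ∀ i k, a i ⬝ᵥ b k = (Pi.single k 1 : Fin n → ℤ) i := fun i k =>
    dotProduct_eq_of_comp_map_x hq hc ha (hb k) i
  have hinj : ∀ γ γ', (∀ i, a i ⬝ᵥ γ = a i ⬝ᵥ γ') → γ = γ' := by
    -- A one-sided inverse of a square integer matrix is two-sided, so the linear system has at most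
    -- one solution. This makes the images homogeneous.
    have h1 : Matrix.of a * (Matrix.of b).transpose = 1 := by
      ext i k
      rw [Matrix.mul_apply', Matrix.one_apply]
      refine (hab i k).trans ?_
      rw [Pi.single_apply]
    have h2 := mul_eq_one_comm.1 h1
    intro γ γ' h
    have h3 : (Matrix.of a).mulVec γ = (Matrix.of a).mulVec γ' := funext h
    have h4 := congrArg ((Matrix.of b).transpose.mulVec) h3
    simpa only [Matrix.mulVec_mulVec, h2, Matrix.one_mulVec] using h4
  refine ⟨b, fun i => comp (toTorus d q (ψ (x d q i))) (b i),
    fun i => comp (toTorus d q (ψ (y d q i))) (-b i), hab, fun i => ⟨hb i, ?_⟩, fun i => ?_⟩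
  · refine eq_mono_of_comp fun γ hγ => hinj _ _ fun k => ?_
    rw [hab, dotProduct_eq_of_comp_map_x hq hc ha hγ]
  · refine eq_mono_of_comp fun γ hγ => hinj _ _ fun k => ?_
    rw [dotProduct_neg, hab, dotProduct_eq_of_comp_map_y hq hc ha hγ, Pi.neg_apply]

/-- The only exponents compatible with the divisibility constraints are signed unit vectors. -/
theorem exists_eq_single_of_dotProduct_eq_one (hd : 1 ≤ d) (hq : ∀ m : ℕ, 1 ≤ m → q ^ m ≠ 1)
    {a b : Fin n → ℤ} {e : K} (he : e ≠ 0) (hab : a ⬝ᵥ b = 1)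
    {f g : LaurentAlg K n} (hfg : f * shift q b g = binom (d • a) e)
    (hf : ∀ j, b j < 0 → binom (Pi.single j (d : ℤ)) 1 ∣ f)
    (hg : ∀ j, 0 < b j → binom (Pi.single j (d : ℤ)) 1 ∣ g) :
    ∃ j, a = b ∧ (b = Pi.single j 1 ∨ b = -Pi.single j 1) := by
  have hd0 : (d : ℤ) ≠ 0 := by exact_mod_cast (Nat.one_le_iff_ne_zero.1 hd)
  -- Whichever sign `b_j` has, `f` or the shifted `g` contributes a binomial in `h_j^d` dividing the
  -- binomial in `h^(d a)`, so `a` is supported at `j`.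
  have key : ∀ j, b j ≠ 0 → ∀ l, l ≠ j → a l = 0 := by
    intro j hj l hl
    have : ∃ e' : K, e' ≠ 0 ∧ binom (Pi.single j (d : ℤ)) e' ∣ binom (d • a) e := by
      rcases lt_or_gt_of_ne hj with hj | hj
      · exact ⟨1, one_ne_zero, hfg ▸ (hf j hj).mul_right _⟩
      · have := map_dvd (shift q b) (hg j hj)
        rw [shift_binom] at this
        exact ⟨_, by rw [one_mul]; exact Units.ne_zero _, hfg ▸ this.mul_left _⟩
    obtain ⟨e', he', hdvd⟩ := this
    have := eq_zero_of_binom_dvd hq hl hd0 he' he hdvd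
    simpa [Nat.one_le_iff_ne_zero.1 hd] using this
  obtain ⟨j, hj⟩ : ∃ j, b j ≠ 0 := by
    by_contra! h0
    rw [show b = 0 from funext h0, dotProduct_zero] at hab
    exact zero_ne_one hab
  have ha : a = Pi.single j (a j) := by
    funext l
    by_cases hl : l = j
    · subst hl; simp
    · rw [key j hj l hl, Pi.single_eq_of_ne hl]
  have hprod : a j * b j = 1 := by rw [ha, single_dotProduct] at hab; exact hab
  have hb : b = Pi.single j (b j) := by
    funext l
    by_cases hl : l = j
    · subst hl; simp
    · rw [Pi.single_eq_of_ne hl]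
      by_contra h0
      rw [key l h0 j (Ne.symm hl), zero_mul] at hprod
      exact zero_ne_one hprod
  refine ⟨j, ?_⟩
  rcases Int.eq_one_or_neg_one_of_mul_eq_one' hprod with h | h
  · rw [ha, hb, h.1, h.2]
    exact ⟨rfl, Or.inl rfl⟩
  · rw [ha, hb, h.1, h.2, Pi.single_neg]
    exact ⟨rfl, Or.inr rfl⟩

theorem toTorus_ofLaurent_mul_x (f : LaurentAlg K n) (j : Fin n) :
    toTorus d q (ofLaurent d q f * x d q j) = mono q (Pi.single j 1) f := by
  rw [map_mul, toTorus_ofLaurent, toTorus_x, mono_mul_mono, zero_add, map_one, mul_one]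

theorem toTorus_ofLaurent_mul_y (f : LaurentAlg K n) (j : Fin n) :
    toTorus d q (ofLaurent d q f * y d q j)
      = mono q (-Pi.single j 1) (f * binom (Pi.single j (d : ℤ)) 1) := by
  rw [map_mul, toTorus_ofLaurent, toTorus_y, mono_mul_mono, zero_add, shift_zero]

/-- Up to units of the Laurent algebra, the endomorphism permutes the pairs `{x_i, y_i}`. -/
theorem exists_map_eq (hd : 1 ≤ d) (hq : ∀ m : ℕ, 1 ≤ m → q ^ m ≠ 1) (hc : ∀ i, c i ≠ 0)
    (ha : ∀ i, toTorus d q (ψ (h d q i)) = mono q 0 (AddMonoidAlgebra.single (a i) (c i)))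
    (i : Fin n) {b : Fin n → ℤ} {f g : LaurentAlg K n} (hab : a i ⬝ᵥ b = 1)
    (hf : toTorus d q (ψ (x d q i)) = mono q b f)
    (hg : toTorus d q (ψ (y d q i)) = mono q (-b) g) :
    ∃ j, a i = b ∧ ∃ u v : LaurentAlg K n, IsUnit u ∧ IsUnit v ∧
      ((b = Pi.single j 1 ∧ ψ (x d q i) = ofLaurent d q u * x d q j ∧
          ψ (y d q i) = ofLaurent d q v * y d q j) ∨
        (b = -Pi.single j 1 ∧ ψ (x d q i) = ofLaurent d q u * y d q j ∧
          ψ (y d q i) = ofLaurent d q v * x d q j)) := by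
  have hfg := toTorus_map_x_mul_y ha i
  rw [hf, hg, mono_mul_mono, add_neg_cancel] at hfg
  replace hfg := mono_injective _ hfg
  have he : ((q : K) * c i) ^ d ≠ 0 := pow_ne_zero _ (mul_ne_zero q.ne_zero (hc i))
  have hfdvd : ∀ j, b j < 0 → binom (Pi.single j (d : ℤ)) 1 ∣ f := fun j hj => by
    have := binom_dvd_comp_toTorus hd (ψ (x d q i)) hj
    rwa [hf, comp_mono_self] at this
  have hgdvd : ∀ j, 0 < b j → binom (Pi.single j (d : ℤ)) 1 ∣ g := fun j hj => by
    have := binom_dvd_comp_toTorus hd (ψ (y d q i)) (β := -b) (j := j) (by simpa using hj)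
    rwa [hg, comp_mono_self] at this
  obtain ⟨j, hai, hb⟩ := exists_eq_single_of_dotProduct_eq_one hd hq he hab hfg hfdvd hgdvd
  refine ⟨j, hai, ?_⟩
  have hj := single_natCast_ne_zero (n := n) hd j
  have hsmul : d • (Pi.single j 1 : Fin n → ℤ) = Pi.single j (d : ℤ) := by
    rw [← Pi.single_smul]; simp
  rcases hb with rfl | rfl
  · obtain ⟨g, rfl⟩ := hgdvd j (by simp)
    -- Once the forced factor is extracted, both sides have a binomial in `h_j^d`, so the remaining
    -- cofactors are units.
    rw [map_mul, shift_binom, mul_left_comm, hai, hsmul] at hfg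
    have hu := isUnit_of_binom_mul_eq hj (by simp) hfg
    refine ⟨f, g, isUnit_of_mul_isUnit_left hu,
      isUnit_of_isUnit_shift (isUnit_of_mul_isUnit_right hu), Or.inl ⟨rfl, ?_, ?_⟩⟩
    · exact toTorus_injective hd (hf.trans (toTorus_ofLaurent_mul_x f j).symm)
    · refine toTorus_injective hd (hg.trans ?_)
      rw [toTorus_ofLaurent_mul_y, mul_comm]
  · obtain ⟨f, rfl⟩ := hfdvd j (by simp)
    rw [mul_assoc, hai, smul_neg, hsmul] at hfg
    have hu := isUnit_of_binom_mul_eq_neg hj one_ne_zero he hfg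
    refine ⟨f, g, isUnit_of_mul_isUnit_left hu,
      isUnit_of_isUnit_shift (isUnit_of_mul_isUnit_right hu), Or.inr ⟨rfl, ?_, ?_⟩⟩
    · refine toTorus_injective hd (hf.trans ?_)
      rw [toTorus_ofLaurent_mul_y, mul_comm]
    · refine toTorus_injective hd (hg.trans ?_)
      rw [neg_neg, toTorus_ofLaurent_mul_x]

/-! ### Bijectivity of endomorphisms -/

theorem exists_toTorus_map_h (hd : 1 ≤ d)
    (ψ : QwaAlgebra d (fun _ : Fin n => q) →ₐ[K] QwaAlgebra d (fun _ : Fin n => q)) :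
    ∃ (a : Fin n → Fin n → ℤ) (c : Fin n → K), (∀ i, c i ≠ 0) ∧
      ∀ i, toTorus d q (ψ (h d q i)) = mono q 0 (AddMonoidAlgebra.single (a i) (c i)) := by
  have : ∀ i, ∃ (a : Fin n → ℤ) (c : K), c ≠ 0 ∧
      toTorus d q (ψ (h d q i)) = mono q 0 (AddMonoidAlgebra.single a c) := fun i =>
    exists_toTorus_eq_of_mul_eq_one hd (v := ψ (hInv d q i)) (by
      rw [← map_mul, h_mul_hInv, map_one])
  choose a c hc ha using this
  exact ⟨a, c, hc, ha⟩

theorem endomorphism_surjective (hd : 1 ≤ d) (hq : ∀ m : ℕ, 1 ≤ m → q ^ m ≠ 1)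
    (ψ : QwaAlgebra d (fun _ : Fin n => q) →ₐ[K] QwaAlgebra d (fun _ : Fin n => q)) :
    Function.Surjective ψ := by
  obtain ⟨a, c, hc, ha⟩ := exists_toTorus_map_h hd ψ
  obtain ⟨b, f, g, hab, hf, hg⟩ := exists_toTorus_map_eq_mono hd hq hc ha
  have hform := fun i => exists_map_eq hd hq hc ha i (by rw [hab, Pi.single_eq_same])
    (hf i).2 (hg i)
  choose p hp u v hu hv huv using hform
  have hb : ∀ i, b i = Pi.single (p i) 1 ∨ b i = -Pi.single (p i) 1 := fun i =>
    (huv i).imp And.left And.left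
  -- Since `a_i = b_i = ±e_(p i)`, a coincidence `p i = p k` would give `a_i · b_k = ±1` instead of
  -- `0`.
  have hpinj : Function.Injective p := by
    intro i k hik
    by_contra hne
    have h1 := hab i k
    rw [hp, Pi.single_eq_of_ne hne] at h1
    rcases hb i with h2 | h2 <;> rcases hb k with h3 | h3 <;>
      simp [h2, h3, hik] at h1
  have hpsurj : Function.Surjective p := Finite.injective_iff_surjective.1 hpinj
  have hψh : ∀ i, ψ (h d q i) = ofLaurent d q (AddMonoidAlgebra.single (b i) (c i)) := fun i => by
    apply toTorus_injective hd
    rw [ha, toTorus_ofLaurent, hp]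
  have hψhInv : ∀ i, ψ (hInv d q i)
      = ofLaurent d q (AddMonoidAlgebra.single (-b i) (c i)⁻¹) := fun i => by
    refine left_inv_eq_right_inv (a := ψ (h d q i)) ?_ ?_
    · rw [← map_mul, hInv_mul_h, map_one]
    · rw [hψh, ← map_mul, AddMonoidAlgebra.single_mul_single, add_neg_cancel,
        mul_inv_cancel₀ (hc i), ← AddMonoidAlgebra.one_def, map_one]
  have hscale : ∀ (e : Fin n → ℤ) (c : K), c ≠ 0 →
      ofLaurent d q (AddMonoidAlgebra.single e c) ∈ ψ.range →
      ofLaurent d q (AddMonoidAlgebra.single e 1) ∈ ψ.range := fun e c hc h => by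
    have := ψ.range.smul_mem h c⁻¹
    rwa [← map_smul, AddMonoidAlgebra.smul_single, smul_eq_mul, inv_mul_cancel₀ hc] at this
  have hpow : ∀ i, ofLaurent d q (AddMonoidAlgebra.single (b i) 1) ∈ ψ.range ∧
      ofLaurent d q (AddMonoidAlgebra.single (-b i) 1) ∈ ψ.range := fun i =>
    ⟨hscale _ _ (hc i) ⟨_, hψh i⟩, hscale _ _ (inv_ne_zero (hc i)) ⟨_, hψhInv i⟩⟩
  have hh : ∀ j, h d q j ∈ ψ.range ∧ hInv d q j ∈ ψ.range := fun j => by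
    obtain ⟨i, rfl⟩ := hpsurj j
    rw [← ofLaurent_h, ← ofLaurent_hInv]
    have h1 := hpow i
    rcases hb i with h2 | h2
    · rwa [h2] at h1
    · rw [h2, neg_neg] at h1
      exact h1.symm
  have hL := ofLaurent_mem (fun j => (hh j).1) (fun j => (hh j).2)
  -- The range already contains all Laurent polynomials, so the unit coefficients can be removed.
  have hcancel : ∀ {u : LaurentAlg K n} {z w}, IsUnit u → ψ w = ofLaurent d q u * z →
      z ∈ ψ.range := fun {u z w} hu hz => by
    obtain ⟨u', hu'⟩ := hu.exists_left_inv
    have := ψ.range.mul_mem (hL u') ⟨w, hz⟩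
    rwa [← mul_assoc, ← map_mul, hu', map_one, one_mul] at this
  have hxy : ∀ j, x d q j ∈ ψ.range ∧ y d q j ∈ ψ.range := fun j => by
    obtain ⟨i, rfl⟩ := hpsurj j
    rcases huv i with ⟨-, h1, h2⟩ | ⟨-, h1, h2⟩
    · exact ⟨hcancel (hu i) h1, hcancel (hv i) h2⟩
    · exact ⟨hcancel (hv i) h2, hcancel (hu i) h1⟩
  exact AlgHom.range_eq_top ψ |>.1 (subalgebra_eq_top (fun j => (hxy j).1) (fun j => (hxy j).2)
    (fun j => (hh j).1) (fun j => (hh j).2))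

/-- An endomorphism is injective on the Laurent algebra. -/
theorem map_ofLaurent_injective (hd : 1 ≤ d) (hq : ∀ m : ℕ, 1 ≤ m → q ^ m ≠ 1)
    (ψ : QwaAlgebra d (fun _ : Fin n => q) →ₐ[K] QwaAlgebra d (fun _ : Fin n => q))
    {f : LaurentAlg K n} (hf : ψ (ofLaurent d q f) = 0) : f = 0 := by
  obtain ⟨a, c, hc, ha⟩ := exists_toTorus_map_h hd ψ
  obtain ⟨b, r, -, -, hr, -⟩ := exists_toTorus_map_eq_mono hd hq hc ha
  have hunit : ∀ e : Fin n → ℤ, ∃ (e' : Fin n → ℤ) (c' : K), c' ≠ 0 ∧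
      toTorus d q (ψ (ofLaurent d q (AddMonoidAlgebra.single e 1)))
        = mono q 0 (AddMonoidAlgebra.single e' c') := fun e =>
    exists_toTorus_eq_of_mul_eq_one hd
      (v := ψ (ofLaurent d q (AddMonoidAlgebra.single (-e) 1))) (by
        rw [← map_mul, ← map_mul, AddMonoidAlgebra.single_mul_single, add_neg_cancel, mul_one,
          ← AddMonoidAlgebra.one_def, map_one, map_one])
  choose e' c' hc' he' using hunit
  -- Applying `ψ` to the commutation of `x_i` with `h^e` recovers `e` from the exponent `e'(e)` of
  -- its image. Distinct monomials thus go to nonzero multiples of distinct monomials.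
  have hdot : ∀ e i, b i ⬝ᵥ e' e = e i := fun e i => by
    have h1 := congrArg (fun z => toTorus d q (ψ z))
      (x_mul_ofLaurent (d := d) (q := q) i (AddMonoidAlgebra.single e 1))
    have h2 : (AddMonoidAlgebra.single e (1 * ((q ^ (Pi.single i 1 ⬝ᵥ e) : Kˣ) : K)) :
        LaurentAlg K n) = ((q ^ e i : Kˣ) : K) • AddMonoidAlgebra.single e 1 := by
      rw [AddMonoidAlgebra.smul_single, single_dotProduct, one_mul, one_mul, smul_eq_mul, mul_one]
    simp only [shift_single, h2, map_smul, map_mul, smul_mul_assoc, he'] at h1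
    rw [dotProduct_comm]
    refine dotProduct_eq_of_comp_ne_zero hq (hc' e) h1 ?_
    rw [(hr i).2, comp_mono_self]
    exact (hr i).1
  have hinj : Function.Injective e' := fun e₁ e₂ h => funext fun i => by
    rw [← hdot e₁, ← hdot e₂, h]
  have hcoeff : ∀ (f : LaurentAlg K n) (e : Fin n → ℤ),
      (comp (toTorus d q (ψ (ofLaurent d q f))) 0).coeff (e' e) = c' e * f.coeff e := by
    intro f e
    induction f using AddMonoidAlgebra.induction_linear with
    | zero => simp [comp_zero]
    | add f g hf hg =>
      simp only [map_add, comp_add, AddMonoidAlgebra.coeff_add, Finsupp.add_apply, hf, hg, mul_add]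
    | single e₁ k =>
      have : (AddMonoidAlgebra.single e₁ k : LaurentAlg K n)
          = k • AddMonoidAlgebra.single e₁ 1 := by
        rw [AddMonoidAlgebra.smul_single, smul_eq_mul, mul_one]
      rw [this, map_smul, map_smul, map_smul, he', comp_smul, comp_mono_self]
      by_cases h : e = e₁
      · subst h
        simp [mul_comm]
      · have h' : e' e ≠ e' e₁ := fun h' => h (hinj h')
        simp [Finsupp.single_eq_of_ne h, Finsupp.single_eq_of_ne h']
  apply AddMonoidAlgebra.coeff_injective
  ext e
  have := hcoeff f e
  rw [hf, map_zero, comp_zero] at this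
  simpa [hc' e] using this.symm

theorem endomorphism_injective (hd : 1 ≤ d) (hq : ∀ m : ℕ, 1 ≤ m → q ^ m ≠ 1)
    (ψ : QwaAlgebra d (fun _ : Fin n => q) →ₐ[K] QwaAlgebra d (fun _ : Fin n => q)) :
    Function.Injective ψ := by
  obtain ⟨a, c, hc, ha⟩ := exists_toTorus_map_h hd ψ
  rw [injective_iff_map_eq_zero]
  intro z hz
  obtain ⟨F, rfl⟩ := ofFinsupp_surjective z
  set t : (Fin n → ℤ) → QwaAlgebra d (fun _ : Fin n => q) := fun β =>
    ofLaurent d q (F β) * xProd d q Finset.univ β with ht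
  -- A degree `γ` occurring in `ψ(t β)` determines `β = A γ`, so different terms cannot cancel each
  -- other.
  have htdeg : ∀ β γ, comp (toTorus d q (ψ (t β))) γ ≠ 0 → β = fun i => a i ⬝ᵥ γ := by
    intro β γ hγ
    funext i
    refine (dotProduct_eq_of_comp_map_ne_zero hq hc ha (fun i => ?_) hγ i).symm
    rw [ht]
    simp only
    rw [mul_assoc, xProd_mul_h hd, mul_smul_comm, ← mul_assoc, ← mul_assoc, ← ofLaurent_h,
      ← map_mul, ← map_mul, mul_comm (F β)]
  have hsum : ∑ β ∈ F.support, toTorus d q (ψ (t β)) = 0 := by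
    rw [← map_sum, ← map_sum, ← ofFinsupp_apply, hz, map_zero]
  have hterm : ∀ β ∈ F.support, ψ (t β) = 0 := by
    intro β hβ
    apply toTorus_injective hd
    rw [map_zero]
    refine ext_comp fun γ => ?_
    rw [comp_zero]
    by_contra hne
    have h1 := congrArg (fun b => comp b γ) hsum
    simp only [comp_sum, comp_zero] at h1
    rw [Finset.sum_eq_single_of_mem β hβ] at h1
    · exact hne h1
    · intro β' _ hβ'
      by_contra hne'
      exact hβ' ((htdeg β' γ hne').trans (htdeg β γ hne).symm)
  have hF : F = 0 := by
    ext1 β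
    rw [Finsupp.zero_apply]
    by_contra hβ
    -- Right multiplication by `x^(-β)` turns the term into the Laurent polynomial `F_β r` with `r ≠
    -- 0`, where injectivity is known.
    obtain ⟨r, hr, hr'⟩ := exists_mul_xProd_neg (K := K) (q := q) hd β
    have h1 : ψ (t β * xProd d q Finset.univ (-β)) = 0 := by
      rw [map_mul, hterm β (Finsupp.mem_support_iff.2 hβ), zero_mul]
    rw [ht] at h1
    simp only at h1
    rw [mul_assoc, hr', ← map_mul] at h1
    exact mul_ne_zero hβ hr (map_ofLaurent_injective hd hq ψ h1)
  rw [hF, map_zero]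

end Endomorphism

end QwaAlgebra

theorem corollary4p2 {K : Type*} [Field K] (n d : ℕ) (hn : 1 ≤ n) (hd : 1 ≤ d)
    (q : Kˣ) (hq : ∀ m : ℕ, 1 ≤ m → q ^ m ≠ 1)
    (ψ : QwaAlgebra d (fun _ : Fin n => q) →ₐ[K] QwaAlgebra d (fun _ : Fin n => q)) :
    ∃ e : QwaAlgebra d (fun _ : Fin n => q) ≃ₐ[K] QwaAlgebra d (fun _ : Fin n => q),
      (e : QwaAlgebra d (fun _ : Fin n => q) →ₐ[K] QwaAlgebra d (fun _ : Fin n => q)) = ψ :=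
  ⟨AlgEquiv.ofBijective ψ ⟨QwaAlgebra.endomorphism_injective hd hq ψ,
    QwaAlgebra.endomorphism_surjective hd hq ψ⟩, AlgHom.ext fun _ => rfl⟩
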